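/- Let $\gamma>0$, $n,m\ge 1$, $N=n+m$, and write points of $\mathbb{R}^N=\mathbb{R}^n\times\mathbb{R}^m$ as $z=(x,y)$. Let $\nabla_\gamma u=(\nabla_x u,\,(1+\gamma)|x|^{\gamma}\nabla_y u)$ be the Grushin gradient, $\Delta_\gamma=\Delta_x+(1+\gamma)^2|x|^{2\gamma}\Delta_y$ the Grushin operator and $Q=n+(1+\gamma)m$ its homogeneous dimension. Let $\Omega\subset\mathbb{R}^N$ be a domain (nonempty, open, connected) and $h\in L^{2Q/(Q+2)}_{loc}(\Omega)$. Let $H^1_\gamma(\Omega)$ be the space of $u\in L^2(\Omega)$ whose weak Grushin gradient $\nabla_\gamma u$ belongs to $L^2(\Omega)$. **Strong Maximum Principle.** Let $u$ be a nonnegative supersolution of $-\Delta_\gamma u+hu$ in $\Omega$, that is: $u\in H^1_\gamma(\Omega)$, $u\ge 0$ a.e. in $\Omega$, $hu\in L^1_{loc}(\Omega)$, and $$\int_\Omega \big(\nabla_\gamma u\cdot\nabla_\gamma\varphi+h\,u\,\varphi\big)\,dz\ \ge\ 0\qquad\text{for all }\varphi\in C_c^\infty(\Omega),\ \varphi\ge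 0.$$ Then either $u>0$ a.e. in $\Omega$, or $u=0$ a.e. in $\Omega$. -/

import Mathlib

open MeasureTheory Set
open scoped ContDiff

noncomputable section

namespace Grushin

/-- The space `ℝ^N = ℝ^n × ℝ^m`, with points `z = (x, y)`; its measure `volume` is the
`N`-dimensional Lebesgue measure. -/
abbrev Space (n m : ℕ) : Type := EuclideanSpace ℝ (Fin n) × EuclideanSpace ℝ (Fin m)

/-- The homogeneous dimension `Q = n + (1 + γ) m` belonging to the dilations
`(x, y) ↦ (t x, t ^ (1 + γ) y)` of `ℝ^n × ℝ^m`. -/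
def homDim (γ : ℝ) (n m : ℕ) : ℝ := n + (1 + γ) * m

/-- The Grushin gradient `∇_γ φ = (∇_x φ, (1 + γ) |x| ^ γ ∇_y φ)` of a differentiable function. -/
def grad (γ : ℝ) {n m : ℕ} (φ : Space n m → ℝ) (z : Space n m) :
    EuclideanSpace ℝ (Fin n ⊕ Fin m) :=
  WithLp.toLp 2 (Sum.elim
    (fun i : Fin n => fderiv ℝ φ z (EuclideanSpace.single i 1, 0))
    (fun j : Fin m => (1 + γ) * ‖z.1‖ ^ γ * fderiv ℝ φ z (0, EuclideanSpace.single j 1)))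

/-- `φ ∈ C_c^∞(Ω)`. -/
def IsTestFunction {n m : ℕ} (Ω : Set (Space n m)) (φ : Space n m → ℝ) : Prop :=
  ContDiff ℝ ∞ φ ∧ HasCompactSupport φ ∧ tsupport φ ⊆ Ω

/-- `G` is the weak Grushin gradient of `u` in `Ω`. The fields `∂_{x_i}` and
`(1 + γ) |x| ^ γ ∂_{y_j}` are formally skew-adjoint, as the coefficient does not depend on `y`. -/
def IsWeakGrad (γ : ℝ) {n m : ℕ} (Ω : Set (Space n m)) (u : Space n m → ℝ)
    (G : Space n m → EuclideanSpace ℝ (Fin n ⊕ Fin m)) : Prop :=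
  ∀ φ, IsTestFunction Ω φ → ∀ k : Fin n ⊕ Fin m,
    ∫ z in Ω, u z * grad γ φ z k = - ∫ z in Ω, G z k * φ z

/-- `u ∈ H^1_γ(Ω)` and `G` is its Grushin gradient: `u ∈ L²(Ω)` and `∇_γ u = G ∈ L²(Ω)`. -/
def MemH1With (γ : ℝ) {n m : ℕ} (Ω : Set (Space n m)) (u : Space n m → ℝ)
    (G : Space n m → EuclideanSpace ℝ (Fin n ⊕ Fin m)) : Prop :=
  MemLp u 2 (volume.restrict Ω) ∧ MemLp G 2 (volume.restrict Ω) ∧ IsWeakGrad γ Ω u G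

/-- `h ∈ L^q_loc(Ω)`, for a finite exponent `q > 0`. -/
def MemLpLoc {n m : ℕ} (Ω : Set (Space n m)) (h : Space n m → ℝ) (q : ℝ) : Prop :=
  ∀ K : Set (Space n m), IsCompact K → K ⊆ Ω → MemLp h (ENNReal.ofReal q) (volume.restrict K)

/-- `u` is a supersolution of `-Δ_γ u + h u` in `Ω`: it belongs to `H^1_γ(Ω)`, the zero-order term
`h u` belongs to `L^1_loc(Ω)`, and `-Δ_γ u + h u ≥ 0` in the sense of distributions. -/
def IsSupersolution (γ : ℝ) {n m : ℕ} (Ω : Set (Space n m)) (h u : Space n m → ℝ) : Prop :=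
  ∃ G : Space n m → EuclideanSpace ℝ (Fin n ⊕ Fin m),
    MemH1With γ Ω u G ∧
    LocallyIntegrableOn (fun z => h z * u z) Ω volume ∧
    ∀ φ, IsTestFunction Ω φ → (∀ z, 0 ≤ φ z) →
      0 ≤ ∫ z in Ω, (inner ℝ (G z) (grad γ φ z) + h z * u z * φ z)

end Grushin

end

/-! The proof is a logarithmic estimate. Testing the inequality with `φ² / (u + δ)` and absorbing
the cross term by Young's inequality bounds `∫ φ² |∇_γ u|² / (u + δ)²` independently of `δ`: since
`0 ≤ u / (u + δ) ≤ 1`, the zero-order term costs at most `∫ φ² |h|`, so only local integrability of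
`h` is needed (`exists_energy_bound`).

Now `φ ∇_γ u / (u + δ)` is `φ` times the gradient of `log (u + δ) - log δ`. Divided by `log (1 /
δ)`, this logarithm tends to the indicator of `{u > 0}`, while its gradient tested against `φ` tends
to zero. Hence the indicator has vanishing weak Grushin gradient
(`integral_indicator_pos_mul_grad_eq_zero`).

The degenerate weight is removed by dividing test functions by a regularization of `|x|^γ`, which
commutes with `∂_y`; the set `{x = 0}` is null. So the ordinary distributional gradient vanishes,
and connectedness makes the indicator a.e. constant.

Nonlinear test functions and the chain rule are justified by smooth nonnegative approximations of
`u` (`exists_smooth_approx`), built as in Friedrichs' lemma with a mollifier whose `x` and `y`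
scales are independent. -/

namespace Grushin
open Filter Topology Metric
open scoped ENNReal Convolution NNReal

/-! ### Mollification and translations in L². -/

section Mollify

variable {E : Type*} [NormedAddCommGroup E] [MeasurableSpace E]

/-- Cauchy–Schwarz after splitting `k * g` as `k^(1/2) * (k^(1/2) * g)`. -/
theorem sq_lintegral_mul_le {α : Type*} [MeasurableSpace α] (μ : Measure α) {k g : α → ℝ≥0∞}
    (hk : AEMeasurable k μ) (hg : AEMeasurable g μ) :
    (∫⁻ w, k w * g w ∂μ) ^ 2 ≤ (∫⁻ w, k w ∂μ) * ∫⁻ w, k w * g w ^ 2 ∂μ := by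
  have key := ENNReal.lintegral_mul_le_Lp_mul_Lq μ (Real.HolderConjugate.two_two)
    (hk.pow_const (1 / 2 : ℝ)) ((hk.pow_const (1 / 2 : ℝ)).mul hg)
  have h1 : ∀ x : ℝ≥0∞, (x ^ (1 / 2 : ℝ)) ^ (2 : ℝ) = x := fun x => by
    rw [← ENNReal.rpow_mul]; norm_num
  have h2 : ∀ x : ℝ≥0∞, (x ^ (1 / 2 : ℝ)) ^ 2 = x := fun x => by
    rw [← ENNReal.rpow_two]; exact h1 x
  have h3 : ∀ x : ℝ≥0∞, x ^ (1 / 2 : ℝ) * x ^ (1 / 2 : ℝ) = x := fun x => by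
    rw [← sq]; exact h2 x
  simp only [Pi.mul_apply, ← mul_assoc, h3, ENNReal.mul_rpow_of_nonneg _ _ (zero_le_two (α := ℝ)),
    h1] at key
  calc _ ≤ ((∫⁻ w, k w ∂μ) ^ (1 / 2 : ℝ) * (∫⁻ w, k w * g w ^ (2 : ℝ) ∂μ) ^ (1 / 2 : ℝ)) ^ 2 := by
        gcongr
    _ = _ := by rw [mul_pow, h2, h2]; simp only [ENNReal.rpow_two]

/-- Weighted Cauchy–Schwarz in `w`, then Tonelli. This one estimate serves both the convergence of
mollifications and Young's convolution inequality. -/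
theorem lintegral_sq_lintegral_mul_le {α β : Type*} [MeasurableSpace α] [MeasurableSpace β]
    (μ : Measure α) [SFinite μ] (ν : Measure β) [SFinite ν] {k : β → ℝ≥0∞} {g : α × β → ℝ≥0∞}
    (hk : Measurable k) (hg : Measurable g) :
    ∫⁻ z, (∫⁻ w, k w * g (z, w) ∂ν) ^ 2 ∂μ ≤
      (∫⁻ w, k w ∂ν) * ∫⁻ w, k w * ∫⁻ z, g (z, w) ^ 2 ∂μ ∂ν := by
  calc _ ≤ ∫⁻ z, (∫⁻ w, k w ∂ν) * ∫⁻ w, k w * g (z, w) ^ 2 ∂ν ∂μ :=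
        lintegral_mono fun z => sq_lintegral_mul_le ν hk.aemeasurable
          (hg.comp measurable_prodMk_left).aemeasurable
    _ = (∫⁻ w, k w ∂ν) * ∫⁻ z, ∫⁻ w, k w * g (z, w) ^ 2 ∂ν ∂μ := by
        rw [lintegral_const_mul]
        exact Measurable.lintegral_prod_right' (f := fun p : α × β => k p.2 * g p ^ 2)
          ((hk.comp measurable_snd).mul (hg.pow_const 2))
    _ = _ := by
        congr 1
        rw [lintegral_lintegral_swap]
        · refine lintegral_congr fun w => ?_
          rw [lintegral_const_mul]
          exact (hg.comp measurable_prodMk_right).pow_const 2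
        · exact ((hk.comp measurable_snd).mul (hg.pow_const 2)).aemeasurable

theorem eLpNorm_two_sq {α F : Type*} [MeasurableSpace α] (μ : Measure α) [NormedAddCommGroup F]
    (f : α → F) : eLpNorm f 2 μ ^ 2 = ∫⁻ z, ‖f z‖ₑ ^ 2 ∂μ := by
  have := eLpNorm_nnreal_pow_eq_lintegral (f := f) (p := 2) (μ := μ) two_ne_zero
  simpa [ENNReal.rpow_two] using this

variable [BorelSpace E] [NormedSpace ℝ E] [FiniteDimensional ℝ E] (μ : Measure E)
  [μ.IsAddHaarMeasure]

theorem tendsto_eLpNorm_translate_sub {f : E → ℝ} (hf : MemLp f 2 μ) :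
    Tendsto (fun w : E => eLpNorm (fun z => f (z - w) - f z) 2 μ) (𝓝 0) (𝓝 0) := by
  let T : C(E, C(E, E)) := (ContinuousMap.mk (fun p : E × E => p.2 - p.1)
    (continuous_snd.sub continuous_fst)).curry
  have hT : ∀ w, MeasurePreserving (T w) μ μ := fun w => measurePreserving_sub_right μ w
  have hlim := (tendsto_const_nhds (x := hf.toLp f) (f := 𝓝 (0 : E))).compMeasurePreservingLp
    (T.continuous.tendsto 0) hT (hT 0) (by norm_num)
  rw [tendsto_iff_edist_tendsto_0] at hlim
  refine hlim.congr fun w => ?_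
  rw [Lp.edist_def]
  refine eLpNorm_congr_ae ?_
  have h1 : ∀ w, ⇑(Lp.compMeasurePreserving (T w) (hT w) (hf.toLp f)) =ᵐ[μ]
      fun z => f (z - w) := fun w =>
    (Lp.coeFn_compMeasurePreserving _ (hT w)).trans
      ((hT w).quasiMeasurePreserving.ae_eq_comp hf.coeFn_toLp)
  filter_upwards [h1 w, h1 0] with z hz hz0
  rw [Pi.sub_apply, hz, hz0, sub_zero]

/-- As `κ` is a probability density, the difference is a `κ`-average of `f (· - w) - f`, and only
translations in the support of `κ` contribute. -/
theorem eLpNorm_convolution_sub_le {f κ : E → ℝ} {c : ℝ≥0∞} (hfm : Measurable f)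
    (hf : MemLp f 2 μ)
    (hκ : Continuous κ) (hκ0 : ∀ w, 0 ≤ κ w) (hκc : HasCompactSupport κ) (hκ1 : ∫ w, κ w ∂μ = 1)
    (hr : ∀ w, κ w ≠ 0 → eLpNorm (fun z => f (z - w) - f z) 2 μ ≤ c) :
    eLpNorm (fun z => (κ ⋆[ContinuousLinearMap.mul ℝ ℝ, μ] f) z - f z) 2 μ ≤ c := by
  have hint : Integrable κ μ := hκ.integrable_of_hasCompactSupport hκc
  have hk1 : ∫⁻ w, ‖κ w‖ₑ ∂μ = 1 := by
    have : ∀ w, ‖κ w‖ₑ = ENNReal.ofReal (κ w) := fun w => by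
      rw [← ofReal_norm, Real.norm_of_nonneg (hκ0 w)]
    simp_rw [this]
    rw [← ofReal_integral_eq_lintegral_ofReal hint (Eventually.of_forall hκ0), hκ1]; simp
  have hloc : LocallyIntegrable f μ := hf.locallyIntegrable (by norm_num)
  have hpt : ∀ z, ‖(κ ⋆[ContinuousLinearMap.mul ℝ ℝ, μ] f) z - f z‖ₑ ≤
      ∫⁻ w, ‖κ w‖ₑ * ‖f (z - w) - f z‖ₑ ∂μ := by
    intro z
    have hex : Integrable (fun w => κ w * f (z - w)) μ :=
      hκc.convolutionExists_left (ContinuousLinearMap.mul ℝ ℝ) hκ hloc z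
    have : (κ ⋆[ContinuousLinearMap.mul ℝ ℝ, μ] f) z - f z = ∫ w, κ w * (f (z - w) - f z) ∂μ := by
      simp_rw [mul_sub]
      rw [integral_sub hex (hint.mul_const _), integral_mul_const, hκ1, one_mul]
      rfl
    rw [this]
    refine (enorm_integral_le_lintegral_enorm _).trans (le_of_eq ?_)
    simp only [enorm_mul]
  rw [← ENNReal.pow_le_pow_left_iff two_ne_zero, eLpNorm_two_sq]
  calc _ ≤ ∫⁻ z, (∫⁻ w, ‖κ w‖ₑ * ‖f (z - w) - f z‖ₑ ∂μ) ^ 2 ∂μ := by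
        exact lintegral_mono fun z => pow_le_pow_left' (hpt z) 2
    _ ≤ (∫⁻ w, ‖κ w‖ₑ ∂μ) * ∫⁻ w, ‖κ w‖ₑ * ∫⁻ z, ‖f (z - w) - f z‖ₑ ^ 2 ∂μ ∂μ :=
        lintegral_sq_lintegral_mul_le μ μ (g := fun p => ‖f (p.1 - p.2) - f p.1‖ₑ)
          hκ.measurable.enorm (by fun_prop)
    _ ≤ 1 * ∫⁻ w, ‖κ w‖ₑ * c ^ 2 ∂μ := by
        rw [hk1]
        refine mul_le_mul_right (lintegral_mono fun w => ?_) _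
        by_cases hw : κ w = 0
        · simp [hw]
        · dsimp only
          rw [← eLpNorm_two_sq]
          gcongr
          exact hr w hw
    _ = c ^ 2 := by rw [lintegral_mul_const _ hκ.measurable.enorm, hk1]; simp

theorem lintegral_sq_kernel_le {f κ : E → ℝ} (hfm : Measurable f) (hκ : Measurable κ) :
    ∫⁻ z, (∫⁻ w, ‖κ w‖ₑ * ‖f (z - w)‖ₑ ∂μ) ^ 2 ∂μ ≤
      ((∫⁻ w, ‖κ w‖ₑ ∂μ) * eLpNorm f 2 μ) ^ 2 := by
  calc _ ≤ (∫⁻ w, ‖κ w‖ₑ ∂μ) * ∫⁻ w, ‖κ w‖ₑ * ∫⁻ z, ‖f (z - w)‖ₑ ^ 2 ∂μ ∂μ :=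
        lintegral_sq_lintegral_mul_le μ μ (g := fun p => ‖f (p.1 - p.2)‖ₑ)
          hκ.enorm (by fun_prop)
    _ = (∫⁻ w, ‖κ w‖ₑ ∂μ) * ∫⁻ w, ‖κ w‖ₑ * ∫⁻ z, ‖f z‖ₑ ^ 2 ∂μ ∂μ := by
        congr 2; ext w
        rw [lintegral_sub_right_eq_self (fun z => ‖f z‖ₑ ^ 2)]
    _ = _ := by
        rw [lintegral_mul_const _ hκ.enorm, ← eLpNorm_two_sq]; ring

theorem fderiv_convolution_left_apply {κ f : E → ℝ} (hκc : HasCompactSupport κ)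
    (hκ : ContDiff ℝ 1 κ) (hf : LocallyIntegrable f μ) (z e : E) :
    fderiv ℝ (κ ⋆[ContinuousLinearMap.mul ℝ ℝ, μ] f) z e = ∫ w, fderiv ℝ κ w e * f (z - w) ∂μ := by
  rw [(hκc.hasFDerivAt_convolution_left (ContinuousLinearMap.mul ℝ ℝ) hκ hf z).fderiv]
  have := (hκc.fderiv ℝ).convolutionExists_left ((ContinuousLinearMap.mul ℝ ℝ).precompL E)
    (hκ.continuous_fderiv one_ne_zero) hf z
  rw [convolution_def, ContinuousLinearMap.integral_apply this]
  rfl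

end Mollify

/-! ### Friedrichs approximation in the Grushin–Sobolev space. -/

section Approximation

variable {n m : ℕ}

instance : (volume : Measure (Space n m)).IsAddHaarMeasure :=
  inferInstanceAs (Measure.prod (volume : Measure (EuclideanSpace ℝ (Fin n)))
    (volume : Measure (EuclideanSpace ℝ (Fin m)))).IsAddHaarMeasure

instance : (volume : Measure (Space n m)).IsNegInvariant :=
  Measure.IsAddHaarMeasure.isNegInvariant_of_regular volume

/-- The coordinate directions of `ℝ^n × ℝ^m`. -/
noncomputable def dir : Fin n ⊕ Fin m → Space n m :=
  Sum.elim (fun i => (EuclideanSpace.single i 1, 0)) (fun j => (0, EuclideanSpace.single j 1))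

/-- The coefficients of the Grushin fields, as functions of `x`. -/
noncomputable def coef (γ : ℝ) (k : Fin n ⊕ Fin m) (x : EuclideanSpace ℝ (Fin n)) : ℝ :=
  Sum.elim (fun _ : Fin n => (1 : ℝ)) (fun _ : Fin m => (1 + γ) * ‖x‖ ^ γ) k

theorem grad_apply (γ : ℝ) (φ : Space n m → ℝ) (z : Space n m) (k : Fin n ⊕ Fin m) :
    grad γ φ z k = coef γ k z.1 * fderiv ℝ φ z (dir k) := by
  cases k <;> simp [grad, coef, dir]

theorem continuous_coef {γ : ℝ} (hγ : 0 < γ) (k : Fin n ⊕ Fin m) :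
    Continuous (coef γ k : EuclideanSpace ℝ (Fin n) → ℝ) := by
  cases k with
  | inl i => exact continuous_const
  | inr j =>
    exact continuous_const.mul (continuous_norm.rpow_const fun _ => Or.inr hγ.le)

/-- A mollifier with independent scales in the two factors. -/
noncomputable def kernel (α : ContDiffBump (0 : EuclideanSpace ℝ (Fin n)))
    (β : ContDiffBump (0 : EuclideanSpace ℝ (Fin m))) (z : Space n m) : ℝ :=
  α.normed volume z.1 * β.normed volume z.2

section Kernel

variable (α : ContDiffBump (0 : EuclideanSpace ℝ (Fin n)))
  (β : ContDiffBump (0 : EuclideanSpace ℝ (Fin m)))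

theorem contDiff_kernel : ContDiff ℝ ∞ (kernel α β) :=
  (α.contDiff_normed.comp contDiff_fst).mul (β.contDiff_normed.comp contDiff_snd)

theorem kernel_nonneg (z : Space n m) : 0 ≤ kernel α β z :=
  mul_nonneg (α.nonneg_normed _) (β.nonneg_normed _)

theorem tsupport_kernel_subset :
    tsupport (kernel α β) ⊆ closedBall 0 α.rOut ×ˢ closedBall 0 β.rOut := by
  refine closure_minimal ?_ (isClosed_closedBall.prod isClosed_closedBall)
  intro z hz
  have h1 : z.1 ∈ Function.support (α.normed volume) := left_ne_zero_of_mul hz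
  have h2 : z.2 ∈ Function.support (β.normed volume) := right_ne_zero_of_mul hz
  rw [α.support_normed_eq] at h1
  rw [β.support_normed_eq] at h2
  exact ⟨ball_subset_closedBall h1, ball_subset_closedBall h2⟩

theorem hasCompactSupport_kernel : HasCompactSupport (kernel α β) :=
  ((isCompact_closedBall _ _).prod (isCompact_closedBall _ _)).of_isClosed_subset
    (isClosed_tsupport _) (tsupport_kernel_subset α β)

theorem integral_kernel : ∫ z, kernel α β z = 1 := by
  have := integral_prod_mul (μ := volume) (ν := volume) (α.normed volume) (β.normed volume)
  rw [α.integral_normed, β.integral_normed, mul_one] at this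
  exact this

theorem fderiv_kernel_inr (j : Fin m) (z : Space n m) :
    fderiv ℝ (kernel α β) z (dir (.inr j)) =
      α.normed volume z.1 * fderiv ℝ (β.normed volume) z.2 (EuclideanSpace.single j 1) := by
  have h1 : HasFDerivAt (fun z : Space n m => α.normed volume z.1) _ z :=
    ((α.contDiff_normed (n := 1)).differentiable (by norm_num) z.1).hasFDerivAt.comp z
      hasFDerivAt_fst
  have h2 : HasFDerivAt (fun z : Space n m => β.normed volume z.2) _ z :=
    ((β.contDiff_normed (n := 1)).differentiable (by norm_num) z.2).hasFDerivAt.comp z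
      hasFDerivAt_snd
  have : fderiv ℝ (kernel α β) z = _ := (h1.mul h2).fderiv
  rw [this]
  simp [dir]

/-- The derivative falls on the `y` factor and the `x` factor has mass one. The value is thus
independent of the `x` scale, which can then be chosen last. -/
theorem lintegral_fderiv_kernel_inr (j : Fin m) :
    ∫⁻ z, ‖fderiv ℝ (kernel α β) z (dir (.inr j))‖ₑ =
      ∫⁻ y, ‖fderiv ℝ (β.normed volume) y (EuclideanSpace.single j 1)‖ₑ := by
  have h1 : ∫⁻ x, ‖α.normed volume x‖ₑ = 1 := by
    have : ∀ w, ‖α.normed volume w‖ₑ = ENNReal.ofReal (α.normed volume w) := fun w => by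
      rw [← ofReal_norm, Real.norm_of_nonneg (α.nonneg_normed w)]
    simp_rw [this]
    rw [← ofReal_integral_eq_lintegral_ofReal α.integrable_normed
      (Eventually.of_forall α.nonneg_normed), α.integral_normed]
    simp
  simp_rw [fderiv_kernel_inr, enorm_mul]
  have := lintegral_prod_mul (μ := volume) (ν := volume)
    (f := fun x => ‖α.normed volume x‖ₑ)
    (g := fun y => ‖fderiv ℝ (β.normed volume) y (EuclideanSpace.single j 1)‖ₑ)
    (α.continuous_normed.measurable.enorm.aemeasurable)
    (((β.contDiff_normed (n := 1)).continuous_fderiv one_ne_zero).clm_apply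
      continuous_const).measurable.enorm.aemeasurable
  rw [h1, one_mul] at this
  exact this

theorem lintegral_fderiv_normed_lt_top (e : EuclideanSpace ℝ (Fin m)) :
    ∫⁻ y, ‖fderiv ℝ (β.normed volume) y e‖ₑ < ⊤ := by
  have hc : Continuous fun y => fderiv ℝ (β.normed volume) y e :=
    ((β.contDiff_normed (n := 1)).continuous_fderiv one_ne_zero).clm_apply continuous_const
  have := hc.integrable_of_hasCompactSupport (μ := volume)
    (β.hasCompactSupport_normed.fderiv_apply ℝ e)
  exact this.2

end Kernel

/-- The weak gradient identity for the test function `w ↦ κ (z - w)`, followed by the substitution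
`w ↦ z - w`. Its support lies in `Ω`, so the values of `U` and `g` outside `Ω` do not matter. -/
theorem integral_mul_fderiv_kernel_of_isWeakGrad {γ : ℝ} {Ω : Set (Space n m)}
    {u U : Space n m → ℝ} {G : Space n m → EuclideanSpace ℝ (Fin n ⊕ Fin m)}
    {g : Space n m → ℝ} {k : Fin n ⊕ Fin m}
    (hG : IsWeakGrad γ Ω u G) (hU : U =ᵐ[volume.restrict Ω] u)
    (hg : g =ᵐ[volume.restrict Ω] fun z => G z k) {κ : Space n m → ℝ} (hκ : ContDiff ℝ ∞ κ)
    (hκc : HasCompactSupport κ) {z : Space n m} (hz : ∀ w ∈ tsupport κ, z - w ∈ Ω) :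
    ∫ w, coef γ k (z - w).1 * fderiv ℝ κ w (dir k) * U (z - w) = ∫ w, κ w * g (z - w) := by
  set φ : Space n m → ℝ := fun w => κ (z - w) with hφ
  have hts : tsupport φ ⊆ (fun w => z - w) ⁻¹' tsupport κ :=
    tsupport_comp_subset_preimage κ (continuous_const.sub continuous_id)
  have htΩ : tsupport φ ⊆ Ω := fun w hw => by simpa using hz _ (hts hw)
  have hφt : IsTestFunction Ω φ :=
    ⟨hκ.comp (contDiff_const.sub contDiff_id),
      hκc.comp_homeomorph (Homeomorph.subLeft z), htΩ⟩
  have hd : ∀ w, fderiv ℝ φ w (dir k) = - fderiv ℝ κ (z - w) (dir k) := fun w => by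
    have h1 : HasFDerivAt (fun w => z - w) (-ContinuousLinearMap.id ℝ (Space n m)) w := by
      simpa using (hasFDerivAt_id w).const_sub z
    have h2 := ((hκ.differentiable (by norm_num)) (z - w)).hasFDerivAt.comp w h1
    rw [show φ = κ ∘ fun w => z - w from rfl, h2.fderiv]
    simp
  have key := hG φ hφt k
  have e1 : ∫ w in Ω, u w * grad γ φ w k =
      - ∫ w, coef γ k w.1 * fderiv ℝ κ (z - w) (dir k) * U w := by
    rw [← integral_neg, ← setIntegral_eq_integral_of_forall_compl_eq_zero (s := Ω)
      (f := fun w => -(coef γ k w.1 * fderiv ℝ κ (z - w) (dir k) * U w))]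
    · refine integral_congr_ae ?_
      filter_upwards [hU] with w hw
      rw [grad_apply, hd, hw]; ring
    · intro w hw
      have : fderiv ℝ κ (z - w) = 0 := by
        have : z - w ∉ tsupport κ := fun h => hw (by simpa using hz _ h)
        exact image_eq_zero_of_notMem_tsupport fun h => this (tsupport_fderiv_subset (𝕜 := ℝ) h)
      simp [this]
  have e2 : ∫ w in Ω, G w k * φ w = ∫ w, κ (z - w) * g w := by
    rw [← setIntegral_eq_integral_of_forall_compl_eq_zero (s := Ω)
      (f := fun w => κ (z - w) * g w)]
    · refine integral_congr_ae ?_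
      filter_upwards [hg] with w hw
      rw [hw]; ring
    · intro w hw
      have : z - w ∉ tsupport κ := fun h => hw (by simpa using hz _ h)
      simp [image_eq_zero_of_notMem_tsupport this]
  rw [e1, e2, neg_inj] at key
  rw [← integral_sub_left_eq_self _ volume z, ← integral_sub_left_eq_self
    (fun w => κ w * g (z - w)) volume z]
  simpa using key

/-- The commutator of the field with mollification is the integral of `(coef z - coef (z - w)) *
∂κ(w) * U (z - w)`. The coefficient difference is at most `τ`, and Young's inequality handles the
rest. -/
theorem eLpNorm_grad_convolution_sub_le {γ : ℝ} (hγ : 0 < γ) {Ω K : Set (Space n m)}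
    (hK : MeasurableSet K)
    {u U : Space n m → ℝ} {G : Space n m → EuclideanSpace ℝ (Fin n ⊕ Fin m)}
    {g : Space n m → ℝ} {k : Fin n ⊕ Fin m}
    (hG : IsWeakGrad γ Ω u G) (hU : U =ᵐ[volume.restrict Ω] u) (hUm : Measurable U)
    (hU2 : MemLp U 2 volume)
    (hg : g =ᵐ[volume.restrict Ω] fun z => G z k) {κ : Space n m → ℝ} (hκ : ContDiff ℝ ∞ κ)
    (hκc : HasCompactSupport κ) (hz : ∀ z ∈ K, ∀ w ∈ tsupport κ, z - w ∈ Ω) {τ : ℝ≥0}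
    (hτ : ∀ z ∈ K, ∀ w ∈ tsupport κ, ‖coef γ k z.1 - coef γ k (z - w).1‖ ≤ τ) :
    eLpNorm (fun z => grad γ (κ ⋆[ContinuousLinearMap.mul ℝ ℝ] U) z k -
        (κ ⋆[ContinuousLinearMap.mul ℝ ℝ] g) z) 2 (volume.restrict K) ≤
      τ * ((∫⁻ w, ‖fderiv ℝ κ w (dir k)‖ₑ) * eLpNorm U 2 volume) := by
  have hUl : LocallyIntegrable U volume := hU2.locallyIntegrable (by norm_num)
  have hκ1 : ContDiff ℝ 1 κ := hκ.of_le (by norm_num)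
  set D : Space n m → ℝ := fun w => fderiv ℝ κ w (dir k) with hD
  have hDc : Continuous D := (hκ1.continuous_fderiv one_ne_zero).clm_apply continuous_const
  have hDs : HasCompactSupport D := hκc.fderiv_apply ℝ _
  have hDz : ∀ w, w ∉ tsupport κ → D w = 0 := fun w hw => by
    have : fderiv ℝ κ w = 0 :=
      image_eq_zero_of_notMem_tsupport fun h => hw (tsupport_fderiv_subset (𝕜 := ℝ) h)
    simp [hD, this]
  have hpt : ∀ z ∈ K, ‖grad γ (κ ⋆[ContinuousLinearMap.mul ℝ ℝ] U) z k -
        (κ ⋆[ContinuousLinearMap.mul ℝ ℝ] g) z‖ₑ ≤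
      τ * ∫⁻ w, ‖D w‖ₑ * ‖U (z - w)‖ₑ := by
    intro z hzK
    have h1 : Integrable (fun w => D w * U (z - w)) volume :=
      hDs.convolutionExists_left (ContinuousLinearMap.mul ℝ ℝ) hDc hUl z
    have hc : Continuous fun w : Space n m => coef γ k (z - w).1 * D w :=
      ((continuous_coef hγ k).comp (continuous_fst.comp (continuous_const.sub continuous_id))).mul
        hDc
    have h2 : Integrable (fun w => coef γ k (z - w).1 * D w * U (z - w)) volume :=
      (hDs.mul_left (f := fun w : Space n m => coef γ k (z - w).1)).convolutionExists_left
        (ContinuousLinearMap.mul ℝ ℝ) hc hUl z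
    have h3 : grad γ (κ ⋆[ContinuousLinearMap.mul ℝ ℝ] U) z k -
        (κ ⋆[ContinuousLinearMap.mul ℝ ℝ] g) z =
        ∫ w, (coef γ k z.1 - coef γ k (z - w).1) * (D w * U (z - w)) := by
      rw [grad_apply, fderiv_convolution_left_apply volume hκc hκ1 hUl]
      have : (κ ⋆[ContinuousLinearMap.mul ℝ ℝ] g) z = ∫ w, κ w * g (z - w) := rfl
      rw [this, ← integral_mul_fderiv_kernel_of_isWeakGrad hG hU hg hκ hκc (hz z hzK),
        ← integral_const_mul, ← integral_sub (h1.const_mul _) h2]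
      congr 1; ext w; ring
    rw [h3, ← lintegral_const_mul' _ _ ENNReal.coe_ne_top]
    refine (enorm_integral_le_lintegral_enorm _).trans (lintegral_mono fun w => ?_)
    by_cases hw : w ∈ tsupport κ
    · simp only [enorm_mul]
      gcongr
      rw [← ofReal_norm, ← ENNReal.ofReal_coe_nnreal]
      exact ENNReal.ofReal_le_ofReal (hτ z hzK w hw)
    · simp [hDz w hw]
  rw [← ENNReal.pow_le_pow_left_iff two_ne_zero, eLpNorm_two_sq]
  calc _ ≤ ∫⁻ z in K, (τ * ∫⁻ w, ‖D w‖ₑ * ‖U (z - w)‖ₑ) ^ 2 :=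
        setLIntegral_mono' hK fun z hz => pow_le_pow_left' (hpt z hz) 2
    _ ≤ ∫⁻ z, (τ * ∫⁻ w, ‖D w‖ₑ * ‖U (z - w)‖ₑ) ^ 2 := setLIntegral_le_lintegral _ _
    _ = τ ^ 2 * ∫⁻ z, (∫⁻ w, ‖D w‖ₑ * ‖U (z - w)‖ₑ) ^ 2 := by
        simp_rw [mul_pow]
        rw [lintegral_const_mul' _ _ (by simp)]
    _ ≤ τ ^ 2 * ((∫⁻ w, ‖D w‖ₑ) * eLpNorm U 2 volume) ^ 2 := by
        gcongr; exact lintegral_sq_kernel_le volume hUm hDc.measurable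
    _ = _ := by rw [mul_pow (τ : ℝ≥0∞)]

theorem exists_measurable_extension {Ω : Set (Space n m)} (hΩ : MeasurableSet Ω)
    {f : Space n m → ℝ} (hf : MemLp f 2 (volume.restrict Ω)) :
    ∃ F : Space n m → ℝ, Measurable F ∧ MemLp F 2 volume ∧ F =ᵐ[volume.restrict Ω] f := by
  have h := (memLp_indicator_iff_restrict hΩ).2 hf
  refine ⟨h.1.mk _, h.1.measurable_mk, h.ae_eq h.1.ae_eq_mk, ?_⟩
  have h1 := ae_restrict_of_ae (s := Ω) h.1.ae_eq_mk
  filter_upwards [h1, ae_restrict_mem hΩ] with z hz hzΩ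
  rw [← hz, indicator_of_mem hzΩ]

theorem exists_coef_modulus {γ : ℝ} (hγ : 0 < γ) {K : Set (Space n m)} (hK : IsCompact K)
    {τ : ℝ≥0} (hτ : 0 < τ) :
    ∃ r > 0, ∀ k : Fin n ⊕ Fin m, ∀ z ∈ K, ∀ w : Space n m, ‖w.1‖ ≤ r →
      ‖coef γ k z.1 - coef γ k (z - w).1‖ ≤ τ := by
  have h : ∀ k : Fin n ⊕ Fin m, ∀ᶠ r in 𝓝[>] (0 : ℝ), ∀ z ∈ K, ∀ w : Space n m, ‖w.1‖ ≤ r →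
      ‖coef γ k z.1 - coef γ k (z - w).1‖ ≤ τ := by
    intro k
    have h1 := (hK.image continuous_fst).uniformContinuousAt_of_continuousAt (coef γ k)
      (fun x _ => (continuous_coef hγ k).continuousAt) (dist_mem_uniformity (NNReal.coe_pos.2 hτ))
    obtain ⟨ε, hε, h2⟩ := mem_uniformity_dist.1 h1
    filter_upwards [Ioo_mem_nhdsGT hε] with r hr z hz w hw
    have h3 := h2 (a := z.1) (b := (z - w).1)
      (by simpa [dist_eq_norm] using hw.trans_lt hr.2) (mem_image_of_mem _ hz)
    exact by
      rw [← dist_eq_norm]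
      exact le_of_lt (show dist _ _ < _ from h3)
  obtain ⟨r, hr, hr0⟩ := ((eventually_all.2 h).and self_mem_nhdsWithin).exists
  exact ⟨r, hr0, hr⟩

/-- The scales are chosen in order: the `y` scale `ρ` makes translations small in L² and fixes the
mass `C` of the `y`-derivatives of the kernel; the `x` scale `σ` then makes the oscillation of the
coefficient small compared with `1 / C`. No differentiability of `|x|^γ` is required. -/
theorem exists_smooth_approx {γ : ℝ} (hγ : 0 < γ) {Ω K : Set (Space n m)}
    (hΩ : IsOpen Ω) (hK : IsCompact K) (hKΩ : K ⊆ Ω)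
    {u : Space n m → ℝ} {G : Space n m → EuclideanSpace ℝ (Fin n ⊕ Fin m)}
    (hu : MemH1With γ Ω u G) (hu0 : ∀ᵐ z ∂(volume.restrict Ω), 0 ≤ u z)
    {ε : ℝ≥0∞} (hε : 0 < ε) :
    ∃ v : Space n m → ℝ, ContDiff ℝ ∞ v ∧ (∀ z, 0 ≤ v z) ∧
      eLpNorm (fun z => v z - u z) 2 (volume.restrict K) ≤ ε ∧
      ∀ k, eLpNorm (fun z => grad γ v z k - G z k) 2 (volume.restrict K) ≤ ε := by
  obtain ⟨hu2, hG2, hG⟩ := hu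
  have hΩm := hΩ.measurableSet
  obtain ⟨U₀, hU₀m, hU₀2, hU₀u⟩ := exists_measurable_extension hΩm hu2
  have hGk : ∀ k, MemLp (fun z => G z k) 2 (volume.restrict Ω) := fun k =>
    (EuclideanSpace.proj (𝕜 := ℝ) k).comp_memLp' hG2
  choose g hgm hg2 hgG using fun k => exists_measurable_extension hΩm (hGk k)
  -- The absolute value changes nothing a.e. in `Ω` and makes the mollification nonnegative
  -- everywhere.
  set U : Space n m → ℝ := fun z => |U₀ z| with hUdef
  have hUm : Measurable U := measurable_abs.comp hU₀m
  have hU2 : MemLp U 2 volume := hU₀2.abs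
  have hUu : U =ᵐ[volume.restrict Ω] u := by
    filter_upwards [hU₀u, hu0] with z h1 h2
    rw [hUdef]; simp only [h1, abs_of_nonneg h2]
  obtain ⟨δ, hδ, hδΩ⟩ := hK.exists_cthickening_subset_open hΩ hKΩ
  have hε2 : 0 < ε / 2 := ENNReal.half_pos hε.ne'
  have hev : ∀ {f : Space n m → ℝ}, MemLp f 2 volume →
      ∀ᶠ w in 𝓝 (0 : Space n m), eLpNorm (fun z => f (z - w) - f z) 2 volume ≤ ε / 2 :=
    fun hf => (tendsto_eLpNorm_translate_sub volume hf).eventually (Iic_mem_nhds hε2)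
  obtain ⟨r, hr, hrb⟩ := Metric.eventually_nhds_iff_ball.1
    ((hev hU2).and (eventually_all.2 fun k => hev (hg2 k)))
  set ρ := min (r / 2) δ with hρdef
  have hρ : 0 < ρ := lt_min (half_pos hr) hδ
  let β : ContDiffBump (0 : EuclideanSpace ℝ (Fin m)) := ⟨ρ / 2, ρ, half_pos hρ, half_lt_self hρ⟩
  set C : ℝ≥0∞ := (∑ j : Fin m,
    ∫⁻ y, ‖fderiv ℝ (β.normed volume) y (EuclideanSpace.single j 1)‖ₑ) * eLpNorm U 2 volume
  have hC : C ≠ ⊤ := ENNReal.mul_ne_top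
    (ENNReal.sum_ne_top.2 fun j _ => (lintegral_fderiv_normed_lt_top β _).ne) hU2.2.ne
  obtain ⟨τ, hτ, hτC⟩ := ENNReal.exists_nnreal_pos_mul_lt hC hε2.ne'
  obtain ⟨s, hs, hsτ⟩ := exists_coef_modulus (m := m) hγ hK hτ
  set σ := min s ρ
  have hσ : 0 < σ := lt_min hs hρ
  let α : ContDiffBump (0 : EuclideanSpace ℝ (Fin n)) := ⟨σ / 2, σ, half_pos hσ, half_lt_self hσ⟩
  set κ := kernel α β
  have hκ : ContDiff ℝ ∞ κ := contDiff_kernel α β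
  have hκc : HasCompactSupport κ := hasCompactSupport_kernel α β
  have hts : ∀ w ∈ tsupport κ, ‖w.1‖ ≤ σ ∧ ‖w‖ ≤ ρ := fun w hw => by
    obtain ⟨h1, h2⟩ := tsupport_kernel_subset α β hw
    rw [mem_closedBall_zero_iff] at h1 h2
    exact ⟨h1, max_le (h1.trans (min_le_right _ _)) h2⟩
  have hzΩ : ∀ z ∈ K, ∀ w ∈ tsupport κ, z - w ∈ Ω := fun z hz w hw =>
    hδΩ (mem_cthickening_of_dist_le _ z _ _ hz (by
      simpa [dist_eq_norm] using (hts w hw).2.trans (min_le_right _ _)))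
  have hball : ∀ w, κ w ≠ 0 → w ∈ ball (0 : Space n m) r := fun w hw => by
    rw [mem_ball_zero_iff]
    have := ((hts w (subset_tsupport _ hw)).2).trans (min_le_left (r / 2) δ)
    linarith
  have hconv : ∀ {f : Space n m → ℝ}, Measurable f → MemLp f 2 volume →
      (∀ w ∈ ball (0 : Space n m) r, eLpNorm (fun z => f (z - w) - f z) 2 volume ≤ ε / 2) →
      eLpNorm (fun z => (κ ⋆[ContinuousLinearMap.mul ℝ ℝ] f) z - f z) 2 volume ≤ ε / 2 :=
    fun hfm hf h => eLpNorm_convolution_sub_le volume hfm hf hκ.continuous (kernel_nonneg α β) hκc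
      (integral_kernel α β) fun w hw => h w (hball w hw)
  have hres : volume.restrict K ≤ volume.restrict Ω := Measure.restrict_mono hKΩ le_rfl
  refine ⟨κ ⋆[ContinuousLinearMap.mul ℝ ℝ] U,
    hκc.contDiff_convolution_left _ hκ (hU2.locallyIntegrable (by norm_num)),
    fun z => integral_nonneg fun w => mul_nonneg (kernel_nonneg α β w) (abs_nonneg _), ?_,
    fun k => ?_⟩
  · calc _ = eLpNorm (fun z => (κ ⋆[ContinuousLinearMap.mul ℝ ℝ] U) z - U z) 2
          (volume.restrict K) := by
          refine eLpNorm_congr_ae ?_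
          filter_upwards [hUu.filter_mono (ae_mono hres)] with z hz
          rw [hz]
      _ ≤ eLpNorm (fun z => (κ ⋆[ContinuousLinearMap.mul ℝ ℝ] U) z - U z) 2 volume :=
          eLpNorm_mono_measure _ Measure.restrict_le_self
      _ ≤ ε / 2 := hconv hUm hU2 fun w hw => (hrb w hw).1
      _ ≤ ε := ENNReal.half_le_self
  · have hg1 : Continuous (κ ⋆[ContinuousLinearMap.mul ℝ ℝ] g k) :=
      hκc.continuous_convolution_left _ hκ.continuous ((hg2 k).locallyIntegrable (by norm_num))
    have hv1 : ContDiff ℝ ∞ (κ ⋆[ContinuousLinearMap.mul ℝ ℝ] U) :=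
      hκc.contDiff_convolution_left _ hκ (hU2.locallyIntegrable (by norm_num))
    have hv2 : Continuous fun z => grad γ (κ ⋆[ContinuousLinearMap.mul ℝ ℝ] U) z k := by
      simp_rw [grad_apply]
      exact ((continuous_coef hγ k).comp continuous_fst).mul
        ((hv1.continuous_fderiv (by norm_num)).clm_apply continuous_const)
    have hb : eLpNorm (fun z => grad γ (κ ⋆[ContinuousLinearMap.mul ℝ ℝ] U) z k -
        (κ ⋆[ContinuousLinearMap.mul ℝ ℝ] g k) z) 2 (volume.restrict K) ≤ ε / 2 := by
      cases k with
      | inl i =>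
        -- The `x` fields have constant coefficients, so their commutator vanishes: `τ = 0`.
        refine (eLpNorm_grad_convolution_sub_le hγ hK.measurableSet hG hUu hUm hU2
          (hgG _) hκ hκc hzΩ (τ := 0) fun z _ w _ => by simp [coef]).trans ?_
        simp
      | inr j =>
        refine (eLpNorm_grad_convolution_sub_le hγ hK.measurableSet hG hUu hUm hU2
          (hgG _) hκ hκc hzΩ (τ := τ) fun z hz w hw =>
            hsτ _ z hz w ((hts w hw).1.trans (min_le_left _ _))).trans (le_trans ?_ hτC.le)
        rw [lintegral_fderiv_kernel_inr]
        refine mul_le_mul_right (mul_le_mul_left ?_ _) _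
        exact Finset.single_le_sum (f := fun j => ∫⁻ y, ‖fderiv ℝ (β.normed volume) y
          (EuclideanSpace.single j 1)‖ₑ) (fun _ _ => zero_le) (Finset.mem_univ j)
    calc _ = eLpNorm ((fun z => grad γ (κ ⋆[ContinuousLinearMap.mul ℝ ℝ] U) z k -
          (κ ⋆[ContinuousLinearMap.mul ℝ ℝ] g k) z) +
          fun z => (κ ⋆[ContinuousLinearMap.mul ℝ ℝ] g k) z - g k z) 2 (volume.restrict K) := by
          refine eLpNorm_congr_ae ?_
          filter_upwards [(hgG k).filter_mono (ae_mono hres)] with z hz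
          simp only [Pi.add_apply, hz]; ring
      _ ≤ _ := eLpNorm_add_le (hv2.sub hg1).aestronglyMeasurable
          (hg1.measurable.sub (hgm k)).aestronglyMeasurable (by norm_num)
      _ ≤ ε / 2 + ε / 2 := add_le_add hb ((eLpNorm_mono_measure _ Measure.restrict_le_self).trans
          (hconv (hgm k) (hg2 k) fun w hw => (hrb w hw).2 k))
      _ = ε := ENNReal.add_halves ε

end Approximation

/-! ### Passing to the limit in products. -/

section Limits

variable {α : Type*} [MeasurableSpace α] {μ : Measure α}

theorem tendsto_integral_bdd_mul {b : ℕ → α → ℝ} {b' F : α → ℝ} {M : ℝ}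
    (hb : ∀ l, AEStronglyMeasurable (b l) μ) (hbM : ∀ l, ∀ᵐ z ∂μ, ‖b l z‖ ≤ M)
    (hlim : ∀ᵐ z ∂μ, Tendsto (fun l => b l z) atTop (𝓝 (b' z))) (hF : Integrable F μ) :
    Tendsto (fun l => ∫ z, b l z * F z ∂μ) atTop (𝓝 (∫ z, b' z * F z ∂μ)) := by
  refine tendsto_integral_of_dominated_convergence (fun z => M * ‖F z‖)
    (fun l => (hb l).mul hF.1) (hF.norm.const_mul M) (fun l => ?_) ?_
  · filter_upwards [hbM l] with z hz
    rw [norm_mul]; gcongr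
  · filter_upwards [hlim] with z hz
    exact hz.mul_const _

/-- Replacing `f l` by `f'` costs at most `M ‖f l - f'‖₂ ‖g‖₂`; dominated convergence treats what
remains, so pointwise convergence of `b l` is enough. -/
theorem tendsto_integral_bdd_mul_mul {b f : ℕ → α → ℝ} {b' f' g : α → ℝ} {M : ℝ}
    (hb : ∀ l, AEStronglyMeasurable (b l) μ) (hbM : ∀ l, ∀ᵐ z ∂μ, ‖b l z‖ ≤ M)
    (hlim : ∀ᵐ z ∂μ, Tendsto (fun l => b l z) atTop (𝓝 (b' z)))
    (hf : ∀ l, MemLp (f l) 2 μ) (hf' : MemLp f' 2 μ) (hg : MemLp g 2 μ)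
    (hff : Tendsto (fun l => eLpNorm (fun z => f l z - f' z) 2 μ) atTop (𝓝 0)) :
    Tendsto (fun l => ∫ z, b l z * (f l z * g z) ∂μ) atTop
      (𝓝 (∫ z, b' z * (f' z * g z) ∂μ)) := by
  have h1 := tendsto_integral_bdd_mul hb hbM hlim (hf'.integrable_mul hg)
  have hi : ∀ l, Integrable (fun z => b l z * ((f l z - f' z) * g z)) μ := fun l =>
    (((hf l).sub hf').integrable_mul hg).bdd_mul (hb l) (hbM l)
  have hi' : ∀ l, Integrable (fun z => b l z * (f' z * g z)) μ := fun l =>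
    (hf'.integrable_mul hg).bdd_mul (hb l) (hbM l)
  have h2 : Tendsto (fun l => ∫ z, b l z * ((f l z - f' z) * g z) ∂μ) atTop (𝓝 0) := by
    have h3 : ∀ l, ∫⁻ z, ‖b l z * ((f l z - f' z) * g z)‖ₑ ∂μ ≤
        ENNReal.ofReal M * (eLpNorm (fun z => f l z - f' z) 2 μ * eLpNorm g 2 μ) := fun l => by
      calc _ ≤ ∫⁻ z, ENNReal.ofReal M * ‖(f l z - f' z) * g z‖ₑ ∂μ := by
            refine lintegral_mono_ae ?_
            filter_upwards [hbM l] with z hz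
            rw [enorm_mul, ← ofReal_norm]
            gcongr
        _ = ENNReal.ofReal M * eLpNorm (fun z => (f l z - f' z) * g z) 1 μ := by
            rw [lintegral_const_mul' _ _ ENNReal.ofReal_ne_top, eLpNorm_one_eq_lintegral_enorm]
        _ ≤ _ := by
            have := eLpNorm_smul_le_mul_eLpNorm (p := 2) (q := 2) (r := 1) hg.1
              (φ := fun z => f l z - f' z) ((hf l).1.sub hf'.1)
            exact mul_le_mul_right this _
    have h4 : Tendsto (fun l => ENNReal.ofReal M *
        (eLpNorm (fun z => f l z - f' z) 2 μ * eLpNorm g 2 μ)) atTop (𝓝 0) := by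
      have := ENNReal.Tendsto.const_mul (a := ENNReal.ofReal M)
        (ENNReal.Tendsto.mul_const (b := eLpNorm g 2 μ) hff (Or.inr hg.2.ne))
        (Or.inr ENNReal.ofReal_ne_top)
      simpa using this
    have h5 := tendsto_integral_of_L1 (μ := μ) (fun _ => (0 : ℝ)) aestronglyMeasurable_const
      (Eventually.of_forall hi) (l := atTop) (by
        refine tendsto_of_tendsto_of_tendsto_of_le_of_le tendsto_const_nhds h4
          (fun _ => zero_le) fun l => ?_
        simpa using h3 l)
    simpa using h5
  have h6 := h2.add h1
  rw [zero_add] at h6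
  simp only [Pi.mul_apply] at h6
  refine h6.congr fun l => ?_
  rw [← integral_add (hi l) (hi' l)]
  congr 1; ext z; ring

end Limits

/-! ### Chain rule for the logarithm and the uniform energy bound. -/

section Energy

variable {n m : ℕ} {γ : ℝ} {Ω K : Set (Space n m)} {u : Space n m → ℝ}
  {G : Space n m → EuclideanSpace ℝ (Fin n ⊕ Fin m)}

theorem memLp_restrict_of_continuous {f : Space n m → ℝ} (hf : Continuous f) (hK : IsCompact K)
    (p : ℝ≥0∞) : MemLp f p (volume.restrict K) := by
  have : IsFiniteMeasure (volume.restrict K) := ⟨by simpa using hK.measure_lt_top⟩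
  obtain ⟨C, hC⟩ := hK.exists_bound_of_continuousOn hf.continuousOn
  exact MemLp.of_bound hf.aestronglyMeasurable C
    ((ae_restrict_mem hK.measurableSet).mono fun z hz => hC z hz)

theorem continuous_grad (hγ : 0 < γ) {φ : Space n m → ℝ} (hφ : ContDiff ℝ ∞ φ)
    (k : Fin n ⊕ Fin m) : Continuous fun z => grad γ φ z k := by
  simp_rw [grad_apply]
  exact ((continuous_coef hγ k).comp continuous_fst).mul
    ((hφ.continuous_fderiv (by norm_num)).clm_apply continuous_const)

theorem grad_eq_zero_of_notMem_tsupport {φ : Space n m → ℝ} {z : Space n m}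
    (hz : z ∉ tsupport φ) (k : Fin n ⊕ Fin m) : grad γ φ z k = 0 := by
  have : fderiv ℝ φ z = 0 :=
    image_eq_zero_of_notMem_tsupport fun h => hz (tsupport_fderiv_subset (𝕜 := ℝ) h)
  simp [grad_apply, this]

/-- Smooth nonnegative functions converging to `u`, with convergence of the Grushin gradients. -/
structure IsApprox (γ : ℝ) (K : Set (Space n m)) (u : Space n m → ℝ)
    (G : Space n m → EuclideanSpace ℝ (Fin n ⊕ Fin m)) (v : ℕ → Space n m → ℝ) : Prop where
  contDiff : ∀ l, ContDiff ℝ ∞ (v l)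
  nonneg : ∀ l z, 0 ≤ v l z
  tendsto : Tendsto (fun l => eLpNorm (fun z => v l z - u z) 2 (volume.restrict K)) atTop (𝓝 0)
  tendsto_grad : ∀ k, Tendsto (fun l => eLpNorm (fun z => grad γ (v l) z k - G z k) 2
    (volume.restrict K)) atTop (𝓝 0)
  tendsto_ae : ∀ᵐ z ∂(volume.restrict K), Tendsto (fun l => v l z) atTop (𝓝 (u z))

/-- Approximations with error `1 / (l + 1)`; a.e. convergence comes from a subsequence, through
convergence in measure. -/
theorem exists_isApprox (hγ : 0 < γ) (hΩ : IsOpen Ω) (hK : IsCompact K) (hKΩ : K ⊆ Ω)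
    (hu : MemH1With γ Ω u G) (hu0 : ∀ᵐ z ∂(volume.restrict Ω), 0 ≤ u z) :
    ∃ v, IsApprox γ K u G v := by
  have hpos : ∀ l : ℕ, (0 : ℝ≥0∞) < ((l : ℝ≥0∞) + 1)⁻¹ := fun l =>
    ENNReal.inv_pos.2 (by finiteness)
  have hlim : Tendsto (fun l : ℕ => ((l : ℝ≥0∞) + 1)⁻¹) atTop (𝓝 0) := by
    have := (tendsto_add_atTop_iff_nat 1).2 ENNReal.tendsto_inv_nat_nhds_zero
    simpa using this
  choose v hv1 hv2 hv3 hv4 using fun l : ℕ => exists_smooth_approx hγ hΩ hK hKΩ hu hu0 (hpos l)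
  have hv : Tendsto (fun l => eLpNorm (fun z => v l z - u z) 2 (volume.restrict K)) atTop (𝓝 0) :=
    tendsto_of_tendsto_of_tendsto_of_le_of_le tendsto_const_nhds hlim (fun _ => zero_le) hv3
  have hres : volume.restrict K ≤ volume.restrict Ω := Measure.restrict_mono hKΩ le_rfl
  obtain ⟨ns, hns, hae⟩ := (tendstoInMeasure_of_tendsto_eLpNorm two_ne_zero
    (fun l => (hv1 l).continuous.aestronglyMeasurable) (hu.1.mono_measure hres).1
    hv).exists_seq_tendsto_ae
  exact ⟨fun l => v (ns l), fun l => hv1 _, fun l => hv2 _, hv.comp hns.tendsto_atTop,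
    fun k => (tendsto_of_tendsto_of_tendsto_of_le_of_le tendsto_const_nhds hlim
      (fun _ => zero_le) fun l => hv4 l k).comp hns.tendsto_atTop, hae⟩

theorem inv_add_le {a δ : ℝ} (ha : 0 ≤ a) (hδ : 0 < δ) : ‖(a + δ)⁻¹‖ ≤ δ⁻¹ := by
  rw [Real.norm_of_nonneg (by positivity)]
  exact inv_anti₀ hδ (by linarith)

theorem contDiff_inv_add {v : Space n m → ℝ} (hv : ContDiff ℝ ∞ v) (hv0 : ∀ z, 0 ≤ v z) {δ : ℝ}
    (hδ : 0 < δ) : ContDiff ℝ ∞ fun z => (v z + δ)⁻¹ :=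
  (hv.add contDiff_const).inv fun z => by have := hv0 z; positivity

theorem grad_sq_mul_inv {φ v : Space n m → ℝ} (hφ : ContDiff ℝ ∞ φ) (hv : ContDiff ℝ ∞ v)
    (hv0 : ∀ z, 0 ≤ v z) {δ : ℝ} (hδ : 0 < δ) (z : Space n m) (k : Fin n ⊕ Fin m) :
    grad γ (fun z => φ z ^ 2 * (v z + δ)⁻¹) z k =
      2 * φ z * (v z + δ)⁻¹ * grad γ φ z k - (φ z * (v z + δ)⁻¹) ^ 2 * grad γ v z k := by
  have hpos : v z + δ ≠ 0 := by have := hv0 z; positivity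
  have h1 := ((hφ.differentiable (by norm_num)) z).hasFDerivAt
  have h2 := ((hv.differentiable (by norm_num)) z).hasFDerivAt
  have h3 : HasFDerivAt (fun z => (v z + δ)⁻¹) _ z :=
    (hasDerivAt_inv hpos).comp_hasFDerivAt z (h2.add_const δ)
  have h4 : HasFDerivAt (fun z => φ z ^ 2 * (v z + δ)⁻¹) _ z := (h1.pow 2).mul h3
  rw [grad_apply, grad_apply, grad_apply, h4.fderiv]
  simp
  field_simp
  ring

theorem grad_mul_log {φ v : Space n m → ℝ} (hφ : ContDiff ℝ ∞ φ) (hv : ContDiff ℝ ∞ v)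
    (hv0 : ∀ z, 0 ≤ v z) {δ : ℝ} (hδ : 0 < δ) (z : Space n m) (k : Fin n ⊕ Fin m) :
    grad γ (fun z => (Real.log (v z + δ) - Real.log δ) * φ z) z k =
      (Real.log (v z + δ) - Real.log δ) * grad γ φ z k +
        φ z * (v z + δ)⁻¹ * grad γ v z k := by
  have hpos : v z + δ ≠ 0 := by have := hv0 z; positivity
  have h1 := ((hφ.differentiable (by norm_num)) z).hasFDerivAt
  have h2 := ((hv.differentiable (by norm_num)) z).hasFDerivAt
  have h3 : HasFDerivAt (fun z => Real.log (v z + δ) - Real.log δ) _ z :=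
    ((h2.add_const δ).log hpos).sub_const _
  have h4 : HasFDerivAt (fun z => (Real.log (v z + δ) - Real.log δ) * φ z) _ z := h3.mul h1
  rw [grad_apply, grad_apply, grad_apply, h4.fderiv]
  simp
  ring

/-- Each coefficient is constant along its own direction, so integration by parts leaves no
zero-order term; only its line derivative is needed. -/
theorem integral_grad_eq_zero (hγ : 0 < γ) {F : Space n m → ℝ} (hF : ContDiff ℝ ∞ F)
    (hFc : HasCompactSupport F) (k : Fin n ⊕ Fin m) : ∫ z, grad γ F z k = 0 := by
  simp_rw [grad_apply]
  have hc : Continuous fun z : Space n m => coef γ k z.1 :=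
    (continuous_coef hγ k).comp continuous_fst
  have hline : ∀ z : Space n m,
      HasLineDerivAt ℝ (fun z : Space n m => coef γ k z.1) 0 z (dir k) := fun z => by
    have : (fun t : ℝ => coef γ k (z + t • dir k).1) = fun _ => coef γ k z.1 := by
      ext t; cases k <;> simp [coef, dir]
    unfold HasLineDerivAt
    rw [this]
    exact hasDerivAt_const _ _
  have := integral_bilinear_hasLineDerivAt_right_eq_neg_left_of_integrable (μ := volume)
    (f := fun z : Space n m => coef γ k z.1) (f' := fun _ => 0) (g := F)
    (g' := fun z => fderiv ℝ F z (dir k)) (v := dir k) (B := ContinuousLinearMap.mul ℝ ℝ)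
    (by simp)
    ((hc.mul ((hF.continuous_fderiv (by norm_num)).clm_apply
      continuous_const)).integrable_of_hasCompactSupport (hFc.fderiv_apply ℝ _).mul_left)
    ((hc.mul hF.continuous).integrable_of_hasCompactSupport hFc.mul_left)
    (fun z _ => hline z)
    (fun z _ => ((hF.differentiable (by norm_num)) z).hasFDerivAt.hasLineDerivAt _)
  simpa using this

theorem abs_log_sub_log_le {a b δ : ℝ} (hδ : 0 < δ) (ha : δ ≤ a) (hb : δ ≤ b) :
    |Real.log a - Real.log b| ≤ δ⁻¹ * |a - b| := by
  have key : ∀ a b : ℝ, δ ≤ a → δ ≤ b → Real.log a - Real.log b ≤ δ⁻¹ * |a - b| := by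
    intro a b ha hb
    have ha0 := hδ.trans_le ha
    have hb0 := hδ.trans_le hb
    rw [← Real.log_div ha0.ne' hb0.ne']
    calc _ ≤ a / b - 1 := Real.log_le_sub_one_of_pos (by positivity)
      _ = b⁻¹ * (a - b) := by field_simp
      _ ≤ b⁻¹ * |a - b| := by gcongr; exact le_abs_self _
      _ ≤ δ⁻¹ * |a - b| := by gcongr
  rw [abs_le]
  have h1 := key a b ha hb
  have h2 := key b a hb ha
  rw [abs_sub_comm] at h2
  constructor <;> linarith

theorem MemH1With.memLp_apply (hu : MemH1With γ Ω u G) (hKΩ : K ⊆ Ω) (k : Fin n ⊕ Fin m) :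
    MemLp (fun z => G z k) 2 (volume.restrict K) :=
  ((EuclideanSpace.proj (𝕜 := ℝ) k).comp_memLp' hu.2.1).mono_measure
    (Measure.restrict_mono hKΩ le_rfl)

theorem memLp_mul_inv_add_mul_grad (hu : MemH1With γ Ω u G)
    (hu0 : ∀ᵐ z ∂(volume.restrict Ω), 0 ≤ u z) {φ : Space n m → ℝ} (hφ : IsTestFunction Ω φ)
    {δ : ℝ} (hδ : 0 < δ) (k : Fin n ⊕ Fin m) :
    MemLp (fun z => φ z * (u z + δ)⁻¹ * G z k) 2 (volume.restrict (tsupport φ)) := by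
  have hres : volume.restrict (tsupport φ) ≤ volume.restrict Ω :=
    Measure.restrict_mono hφ.2.2 le_rfl
  obtain ⟨M, hM⟩ := hφ.2.1.exists_bound_of_continuous hφ.1.continuous
  refine (hu.memLp_apply hφ.2.2 k).of_le_mul (c := M * δ⁻¹)
    ((hφ.1.continuous.aestronglyMeasurable.mul ?_).mul (hu.memLp_apply hφ.2.2 k).1) ?_
  · exact ((hu.1.mono_measure hres).1.aemeasurable.add_const δ).inv.aestronglyMeasurable
  · filter_upwards [hu0.filter_mono (ae_mono hres)] with z hz
    rw [norm_mul, norm_mul]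
    gcongr
    · exact (norm_nonneg _).trans (hM z)
    · exact hM z
    · exact inv_add_le hz hδ

/-- The weak chain rule for `log (u + δ) - log δ`: it holds for the smooth approximations by
integrating `grad_mul_log`, and passes to the limit because `log` is `δ⁻¹`-Lipschitz on `[δ, ∞)`. -/
theorem integral_log_mul_grad (hγ : 0 < γ) (hΩ : IsOpen Ω) (hu : MemH1With γ Ω u G)
    (hu0 : ∀ᵐ z ∂(volume.restrict Ω), 0 ≤ u z) {φ : Space n m → ℝ} (hφ : IsTestFunction Ω φ)
    {δ : ℝ} (hδ : 0 < δ) (k : Fin n ⊕ Fin m) :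
    ∫ z in tsupport φ, (Real.log (u z + δ) - Real.log δ) * grad γ φ z k =
      - ∫ z in tsupport φ, φ z * (u z + δ)⁻¹ * G z k := by
  obtain ⟨hφs, hφc, hφΩ⟩ := hφ
  have hK : IsCompact (tsupport φ) := hφc
  obtain ⟨v, hv⟩ := exists_isApprox hγ hΩ hK hφΩ hu hu0
  have hres : volume.restrict (tsupport φ) ≤ volume.restrict Ω :=
    Measure.restrict_mono hφΩ le_rfl
  have hu0' := hu0.filter_mono (ae_mono hres)
  have hu2 := hu.1.mono_measure hres
  obtain ⟨M, hM⟩ := hφc.exists_bound_of_continuous hφs.continuous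
  have hgc := continuous_grad hγ hφs k
  have hLs : ∀ l, ContDiff ℝ ∞ fun z => Real.log (v l z + δ) - Real.log δ := fun l =>
    (((hv.contDiff l).add contDiff_const).log fun z => by
      have := hv.nonneg l z; positivity).sub contDiff_const
  have hsc : ∀ l, Continuous fun z => φ z * (v l z + δ)⁻¹ := fun l =>
    hφs.continuous.mul (contDiff_inv_add (hv.contDiff l) (hv.nonneg l) hδ).continuous
  have hLu : MemLp (fun z => Real.log (u z + δ) - Real.log δ) 2 (volume.restrict (tsupport φ)) := by
    refine hu2.of_le_mul (c := δ⁻¹) ?_ ?_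
    · exact ((hu2.1.aemeasurable.add_const δ).log.sub_const _).aestronglyMeasurable
    · filter_upwards [hu0'] with z hz
      have := abs_log_sub_log_le hδ (a := u z + δ) (b := δ) (by linarith) le_rfl
      simpa using this
  have h1 : Tendsto (fun l => ∫ z in tsupport φ,
      (Real.log (v l z + δ) - Real.log δ) * grad γ φ z k) atTop
      (𝓝 (∫ z in tsupport φ, (Real.log (u z + δ) - Real.log δ) * grad γ φ z k)) := by
    have := tendsto_integral_bdd_mul_mul (μ := volume.restrict (tsupport φ))
      (b := fun _ _ => 1) (b' := fun _ => 1) (M := 1)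
      (f := fun l z => Real.log (v l z + δ) - Real.log δ)
      (f' := fun z => Real.log (u z + δ) - Real.log δ) (g := fun z => grad γ φ z k)
      (fun _ => aestronglyMeasurable_const) (fun _ => by simp) (by simp)
      (fun l => memLp_restrict_of_continuous (hLs l).continuous hK 2) hLu
      (memLp_restrict_of_continuous hgc hK 2) ?_
    · simpa using this
    · have hb : Tendsto (fun l => ENNReal.ofReal δ⁻¹ *
          eLpNorm (fun z => v l z - u z) 2 (volume.restrict (tsupport φ))) atTop (𝓝 0) := by
        simpa using ENNReal.Tendsto.const_mul hv.tendsto (Or.inr ENNReal.ofReal_ne_top)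
      refine tendsto_of_tendsto_of_tendsto_of_le_of_le tendsto_const_nhds hb
        (fun _ => zero_le) fun l => eLpNorm_le_mul_eLpNorm_of_ae_le_mul ?_ 2
      filter_upwards [hu0'] with z hz
      have := abs_log_sub_log_le hδ (a := v l z + δ) (b := u z + δ)
        (by linarith [hv.nonneg l z]) (by linarith)
      simpa using this
  have h2 : Tendsto (fun l => ∫ z in tsupport φ, φ z * (v l z + δ)⁻¹ * (grad γ (v l) z k * 1))
      atTop (𝓝 (∫ z in tsupport φ, φ z * (u z + δ)⁻¹ * (G z k * 1))) := by
    refine tendsto_integral_bdd_mul_mul (μ := volume.restrict (tsupport φ)) (M := M * δ⁻¹)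
      (fun l => (hsc l).aestronglyMeasurable) (fun l => Eventually.of_forall fun z => ?_) ?_
      (fun l => memLp_restrict_of_continuous (continuous_grad hγ (hv.contDiff l) k) hK 2)
      (hu.memLp_apply hφΩ k) (memLp_restrict_of_continuous continuous_const hK 2)
      (hv.tendsto_grad k)
    · rw [norm_mul]
      gcongr
      · exact (norm_nonneg _).trans (hM z)
      · exact hM z
      · exact inv_add_le (hv.nonneg l z) hδ
    · filter_upwards [hv.tendsto_ae, hu0'] with z hz hz0
      exact ((hz.add_const δ).inv₀ (by positivity)).const_mul _
  simp only [mul_one] at h2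
  refine tendsto_nhds_unique h1 (h2.neg.congr fun l => ?_)
  have hF := integral_grad_eq_zero hγ ((hLs l).mul hφs) (hφc.mul_left) k
  rw [← setIntegral_eq_integral_of_forall_compl_eq_zero (s := tsupport φ)] at hF
  · have e : ∀ z, grad γ (fun z => (Real.log (v l z + δ) - Real.log δ) * φ z) z k = _ := fun z =>
      grad_mul_log hφs (hv.contDiff l) (hv.nonneg l) hδ z k
    change ∫ z in tsupport φ,
      grad γ (fun z => (Real.log (v l z + δ) - Real.log δ) * φ z) z k = 0 at hF
    simp_rw [e] at hF
    rw [integral_add] at hF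
    · linarith
    · exact memLp_one_iff_integrable.1 (memLp_restrict_of_continuous ((hLs l).continuous.mul hgc) hK 1)
    · exact memLp_one_iff_integrable.1 (memLp_restrict_of_continuous ((hsc l).mul
        (continuous_grad hγ (hv.contDiff l) k)) hK 1)
  · intro z hz
    exact grad_eq_zero_of_notMem_tsupport (fun h => hz (tsupport_mul_subset_right h)) k

/-- The logarithmic Caccioppoli estimate. What matters is that `C` is chosen before `δ`. -/
theorem exists_energy_bound (hγ : 0 < γ) (hΩ : IsOpen Ω) (hu : MemH1With γ Ω u G)
    (hu0 : ∀ᵐ z ∂(volume.restrict Ω), 0 ≤ u z) {h : Space n m → ℝ}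
    (hh : ∀ K, IsCompact K → K ⊆ Ω → IntegrableOn h K)
    (hhu : LocallyIntegrableOn (fun z => h z * u z) Ω)
    (hsup : ∀ φ, IsTestFunction Ω φ → (∀ z, 0 ≤ φ z) →
      0 ≤ ∫ z in Ω, (inner ℝ (G z) (grad γ φ z) + h z * u z * φ z))
    {φ : Space n m → ℝ} (hφ : IsTestFunction Ω φ) :
    ∃ C, ∀ δ > 0, ∀ k, ∫ z in tsupport φ, (φ z * (u z + δ)⁻¹ * G z k) ^ 2 ≤ C := by
  have hL := fun {δ : ℝ} (hδ : 0 < δ) k => memLp_mul_inv_add_mul_grad (k := k) hu hu0 hφ hδ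
  obtain ⟨hφs, hφc, hφΩ⟩ := hφ
  set K := tsupport φ
  have hK : IsCompact K := hφc
  obtain ⟨v, hv⟩ := exists_isApprox hγ hΩ hK hφΩ hu hu0
  have hres : volume.restrict K ≤ volume.restrict Ω := Measure.restrict_mono hφΩ le_rfl
  have hu0' := hu0.filter_mono (ae_mono hres)
  have hu2 := hu.1.mono_measure hres
  obtain ⟨M, hM⟩ := hφc.exists_bound_of_continuous hφs.continuous
  have hgc := continuous_grad hγ hφs
  have hg2 := fun k => memLp_restrict_of_continuous (hgc k) hK 2
  have hGk := hu.memLp_apply hφΩ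
  have hhuK : IntegrableOn (fun z => h z * u z) K := hhu.integrableOn_compact_subset hφΩ hK
  have hhK := hh K hK hφΩ
  have hφ2 : Integrable (fun z => φ z ^ 2 * |h z|) (volume.restrict K) :=
    hhK.abs.bdd_mul (c := M ^ 2) (hφs.continuous.pow 2).aestronglyMeasurable
      (Eventually.of_forall fun z => by rw [norm_pow]; gcongr; exact hM z)
  -- Young's inequality in the form `2ab ≤ a²/2 + 2b²` leaves half of the energy on the left; the
  -- outer factor `2` removes that half.
  refine ⟨2 * (2 * (∑ k, ∫ z in K, (grad γ φ z k) ^ 2) + ∫ z in K, φ z ^ 2 * |h z|),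
    fun δ hδ k₀ => ?_⟩
  have hsc : ∀ l, Continuous fun z => (v l z + δ)⁻¹ := fun l =>
    (contDiff_inv_add (hv.contDiff l) (hv.nonneg l) hδ).continuous
  have hsb : ∀ l z, ‖φ z * (v l z + δ)⁻¹‖ ≤ M * δ⁻¹ := fun l z => by
    rw [norm_mul]
    gcongr
    · exact (norm_nonneg _).trans (hM z)
    · exact hM z
    · exact inv_add_le (hv.nonneg l z) hδ
  have hst : ∀ᵐ z ∂(volume.restrict K), Tendsto (fun l => (v l z + δ)⁻¹) atTop
      (𝓝 (u z + δ)⁻¹) := by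
    filter_upwards [hv.tendsto_ae, hu0'] with z hz hz0
    exact (hz.add_const δ).inv₀ (by positivity)
  have hA : ∀ k, Tendsto (fun l => ∫ z in K, φ z * (v l z + δ)⁻¹ * (G z k * grad γ φ z k)) atTop
      (𝓝 (∫ z in K, φ z * (u z + δ)⁻¹ * (G z k * grad γ φ z k))) := fun k =>
    tendsto_integral_bdd_mul (M := M * δ⁻¹)
      (fun l => (hφs.continuous.mul (hsc l)).aestronglyMeasurable)
      (fun l => Eventually.of_forall (hsb l)) (hst.mono fun z hz => hz.const_mul _)
      ((hGk k).integrable_mul (hg2 k))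
  -- The mixed product `∇v_l · G` appears because the test function is built from `v l` while the
  -- inequality contains the gradient of `u`.
  have hB : ∀ k, Tendsto (fun l => ∫ z in K, (φ z * (v l z + δ)⁻¹) ^ 2 * (grad γ (v l) z k * G z k))
      atTop (𝓝 (∫ z in K, (φ z * (u z + δ)⁻¹) ^ 2 * (G z k * G z k))) := fun k =>
    tendsto_integral_bdd_mul_mul (M := (M * δ⁻¹) ^ 2)
      (fun l => ((hφs.continuous.mul (hsc l)).pow 2).aestronglyMeasurable)
      (fun l => Eventually.of_forall fun z => by rw [norm_pow]; gcongr; exact hsb l z)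
      (hst.mono fun z hz => (hz.const_mul _).pow 2)
      (fun l => memLp_restrict_of_continuous (continuous_grad hγ (hv.contDiff l) k) hK 2)
      (hGk k) (hGk k) (hv.tendsto_grad k)
  have hcb : ∀ l z, ‖φ z ^ 2 * (v l z + δ)⁻¹‖ ≤ M ^ 2 * δ⁻¹ := fun l z => by
    rw [norm_mul, norm_pow]
    gcongr
    · exact hM z
    · exact inv_add_le (hv.nonneg l z) hδ
  have hcm : ∀ l, AEStronglyMeasurable (fun z => φ z ^ 2 * (v l z + δ)⁻¹) (volume.restrict K) :=
    fun l => ((hφs.continuous.pow 2).mul (hsc l)).aestronglyMeasurable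
  have hC : Tendsto (fun l => ∫ z in K, φ z ^ 2 * (v l z + δ)⁻¹ * (h z * u z)) atTop
      (𝓝 (∫ z in K, φ z ^ 2 * (u z + δ)⁻¹ * (h z * u z))) :=
    tendsto_integral_bdd_mul (M := M ^ 2 * δ⁻¹) hcm (fun l => Eventually.of_forall (hcb l))
      (hst.mono fun z hz => hz.const_mul _) hhuK
  -- The supersolution inequality for the smooth test function `φ² / (v l + δ)`.
  have hle : ∀ l, 0 ≤ (∑ k, (2 * (∫ z in K, φ z * (v l z + δ)⁻¹ * (G z k * grad γ φ z k)) -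
      ∫ z in K, (φ z * (v l z + δ)⁻¹) ^ 2 * (grad γ (v l) z k * G z k))) +
      ∫ z in K, φ z ^ 2 * (v l z + δ)⁻¹ * (h z * u z) := by
    intro l
    set ψ : Space n m → ℝ := fun z => φ z ^ 2 * (v l z + δ)⁻¹
    have hψK : tsupport ψ ⊆ K := (tsupport_mul_subset_left (f := fun z => φ z ^ 2)).trans
      (closure_mono fun z hz => by
        simp only [Function.mem_support, ne_eq, pow_eq_zero_iff, OfNat.ofNat_ne_zero,
          not_false_eq_true] at hz ⊢
        exact hz)
    have hψ : IsTestFunction Ω ψ :=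
      ⟨(hφs.pow 2).mul (contDiff_inv_add (hv.contDiff l) (hv.nonneg l) hδ),
        hK.of_isClosed_subset (isClosed_tsupport _) hψK, hψK.trans hφΩ⟩
    have hnn := hsup ψ hψ fun z => by have := hv.nonneg l z; positivity
    rw [setIntegral_eq_of_subset_of_forall_sdiff_eq_zero hΩ.measurableSet hφΩ] at hnn
    · refine hnn.trans_eq ?_
      have iA : ∀ k, Integrable (fun z => φ z * (v l z + δ)⁻¹ * (G z k * grad γ φ z k))
          (volume.restrict K) := fun k => ((hGk k).integrable_mul (hg2 k)).bdd_mul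
            (hφs.continuous.mul (hsc l)).aestronglyMeasurable (Eventually.of_forall (hsb l))
      have iB : ∀ k, Integrable (fun z => (φ z * (v l z + δ)⁻¹) ^ 2 * (grad γ (v l) z k * G z k))
          (volume.restrict K) := fun k =>
        ((memLp_restrict_of_continuous (continuous_grad hγ (hv.contDiff l) k) hK 2).integrable_mul
          (hGk k)).bdd_mul (c := (M * δ⁻¹) ^ 2)
            ((hφs.continuous.mul (hsc l)).pow 2).aestronglyMeasurable
            (Eventually.of_forall fun z => by rw [norm_pow]; gcongr; exact hsb l z)
      have iC : Integrable (fun z => φ z ^ 2 * (v l z + δ)⁻¹ * (h z * u z)) (volume.restrict K) :=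
        Integrable.bdd_mul hhuK (hcm l) (Eventually.of_forall (hcb l))
      have iAB : ∀ k, Integrable (fun z => 2 * (φ z * (v l z + δ)⁻¹ * (G z k * grad γ φ z k)) -
          (φ z * (v l z + δ)⁻¹) ^ 2 * (grad γ (v l) z k * G z k)) (volume.restrict K) := fun k => ((iA k).const_mul 2).sub (iB k)
      have e : ∀ k, 2 * (∫ z in K, φ z * (v l z + δ)⁻¹ * (G z k * grad γ φ z k)) -
          ∫ z in K, (φ z * (v l z + δ)⁻¹) ^ 2 * (grad γ (v l) z k * G z k) =
          ∫ z in K, (2 * (φ z * (v l z + δ)⁻¹ * (G z k * grad γ φ z k)) -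
            (φ z * (v l z + δ)⁻¹) ^ 2 * (grad γ (v l) z k * G z k)) := fun k => by
        rw [integral_sub ((iA k).const_mul 2) (iB k), integral_const_mul]
      simp_rw [e]
      rw [← integral_finsetSum _ fun k _ => iAB k, ← integral_add (integrable_finsetSum _
        fun k _ => iAB k) iC]
      congr 1; ext z
      rw [PiLp.inner_apply]
      congr 1
      · refine Finset.sum_congr rfl fun k _ => ?_
        rw [grad_sq_mul_inv hφs (hv.contDiff l) (hv.nonneg l) hδ]
        simp; ring
      · ring
    · intro z hz
      have hz' : z ∉ tsupport ψ := fun h => hz.2 (hψK h)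
      have h1 : grad γ ψ z = 0 := by
        ext k; simpa using grad_eq_zero_of_notMem_tsupport hz' k
      rw [h1, image_eq_zero_of_notMem_tsupport hz']; simp
  have hlim := ge_of_tendsto' ((tendsto_finsetSum Finset.univ fun k _ =>
    ((hA k).const_mul 2).sub (hB k)).add hC) hle
  have hBe : ∀ k, ∫ z in K, (φ z * (u z + δ)⁻¹) ^ 2 * (G z k * G z k) =
      ∫ z in K, (φ z * (u z + δ)⁻¹ * G z k) ^ 2 := fun k => by
    congr 1; ext z; ring
  have hAB : ∀ k, 2 * (∫ z in K, φ z * (u z + δ)⁻¹ * (G z k * grad γ φ z k)) ≤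
      (∫ z in K, (φ z * (u z + δ)⁻¹ * G z k) ^ 2) / 2 + 2 * ∫ z in K, (grad γ φ z k) ^ 2 := by
    intro k
    have i1 := (hL hδ k).integrable_sq
    have i2 := (hg2 k).integrable_sq
    have i3 := (hL hδ k).integrable_mul (hg2 k)
    rw [← integral_const_mul, ← integral_const_mul, ← integral_div, ← integral_add (i1.div_const 2)
      (i2.const_mul 2)]
    refine integral_mono ((i3.const_mul 2).congr (Eventually.of_forall fun z => ?_))
      ((i1.div_const 2).add (i2.const_mul 2)) fun z => ?_
    · simp only [Pi.mul_apply]; ring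
    · dsimp only
      nlinarith [sq_nonneg (φ z * (u z + δ)⁻¹ * G z k - 2 * grad γ φ z k)]
  have hCle : ∫ z in K, φ z ^ 2 * (u z + δ)⁻¹ * (h z * u z) ≤ ∫ z in K, φ z ^ 2 * |h z| := by
    have hb : ∀ᵐ z ∂(volume.restrict K),
        ‖φ z ^ 2 * (u z + δ)⁻¹ * (h z * u z)‖ ≤ φ z ^ 2 * |h z| := by
      filter_upwards [hu0'] with z hz
      have h1 : (u z + δ)⁻¹ * u z ≤ 1 := by
        rw [inv_mul_le_one₀ (by positivity)]; linarith
      have h2 : 0 ≤ (u z + δ)⁻¹ * u z := by positivity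
      calc _ = φ z ^ 2 * |h z| * ((u z + δ)⁻¹ * u z) := by
            rw [show φ z ^ 2 * (u z + δ)⁻¹ * (h z * u z) =
              φ z ^ 2 * h z * ((u z + δ)⁻¹ * u z) by ring, norm_mul, norm_mul,
              Real.norm_of_nonneg h2, Real.norm_of_nonneg (sq_nonneg _), Real.norm_eq_abs]
        _ ≤ _ := mul_le_of_le_one_right (by positivity) h1
    refine integral_mono_ae (hφ2.mono' ?_ hb) hφ2 (hb.mono fun z hz => (le_abs_self _).trans hz)
    exact (((hφs.continuous.pow 2).aestronglyMeasurable).mul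
      (hu2.1.aemeasurable.add_const δ).inv.aestronglyMeasurable).mul hhuK.1
  have hsum := Finset.sum_le_sum fun k (_ : k ∈ Finset.univ) => hAB k
  have hone : ∫ z in K, (φ z * (u z + δ)⁻¹ * G z k₀) ^ 2 ≤
      ∑ k, ∫ z in K, (φ z * (u z + δ)⁻¹ * G z k) ^ 2 :=
    Finset.single_le_sum (f := fun k => ∫ z in K, (φ z * (u z + δ)⁻¹ * G z k) ^ 2)
      (fun k _ => integral_nonneg fun z => sq_nonneg _) (Finset.mem_univ k₀)
  simp only [hBe, Finset.sum_sub_distrib] at hlim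
  rw [Finset.sum_add_distrib, ← Finset.sum_div] at hsum
  simp only [← Finset.mul_sum] at hsum hlim
  linarith

end Energy
-- Vanishing distributional gradient and connectedness.
section LocallyConstant

theorem isOpen_setOf_ae_ball {E : Type*} [PseudoMetricSpace E] [MeasurableSpace E] (μ : Measure E)
    (p : E → Prop) :
    IsOpen {z | ∃ r > 0, ∀ᵐ w ∂(μ.restrict (ball z r)), p w} := by
  rw [Metric.isOpen_iff]
  rintro z ⟨r, hr, h⟩
  refine ⟨r, hr, fun w hw => ⟨r - dist w z, sub_pos.2 hw, ?_⟩⟩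
  exact ae_restrict_of_ae_restrict_of_subset (ball_subset_ball' (by linarith)) h

theorem ae_restrict_of_forall_ae_ball {E : Type*} [PseudoMetricSpace E]
    [SecondCountableTopology E] [MeasurableSpace E] [OpensMeasurableSpace E] (μ : Measure E) {Ω : Set E} {p : E → Prop}
    (h : ∀ z ∈ Ω, ∃ r > 0, ∀ᵐ w ∂(μ.restrict (ball z r)), p w) (hΩ : MeasurableSet Ω) :
    ∀ᵐ z ∂(μ.restrict Ω), p z := by
  rw [ae_restrict_iff' hΩ, ae_iff]
  refine measure_null_of_locally_null _ fun z hz => ?_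
  simp only [Classical.not_imp, mem_ofPred_eq] at hz
  obtain ⟨r, hr, hw⟩ := h z hz.1
  rw [ae_restrict_iff' measurableSet_ball, ae_iff] at hw
  refine ⟨ball z r ∩ {a | ¬(a ∈ Ω → p a)}, inter_mem
    (mem_nhdsWithin_of_mem_nhds (ball_mem_nhds z hr)) self_mem_nhdsWithin, measure_mono_null ?_ hw⟩
  rintro w ⟨hwb, hwp⟩ h'
  exact hwp fun _ => h' hwb

variable {E : Type*} [NormedAddCommGroup E] [NormedSpace ℝ E] [FiniteDimensional ℝ E]
  [MeasurableSpace E] [BorelSpace E] (μ : Measure E) [μ.IsAddHaarMeasure]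

/-- Mollifications of `f` have zero derivative on the ball, hence are constant there, and they
converge to `f` a.e. -/
theorem ae_const_on_ball_of_integral_mul_fderiv_eq_zero {f : E → ℝ} (hf : LocallyIntegrable f μ)
    {Ω : Set E}
    (h : ∀ φ : E → ℝ, ContDiff ℝ ∞ φ → HasCompactSupport φ → tsupport φ ⊆ Ω →
      ∀ v, ∫ z, f z * fderiv ℝ φ z v ∂μ = 0) {z₀ : E} {r : ℝ} (hr : 0 < r)
    (hball : ball z₀ (2 * r) ⊆ Ω) :
    ∃ z₁ ∈ ball z₀ r, ∀ᵐ z ∂(μ.restrict (ball z₀ r)), f z = f z₁ := by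
  -- With `l + 2` every radius is strictly below `r`, so translates centred in `ball z₀ r` stay
  -- supported in `ball z₀ (2 * r)`; the fixed ratio of the radii is required for a.e. convergence.
  let ψ : ℕ → ContDiffBump (0 : E) := fun l =>
    ⟨r / (l + 2) / 2, r / (l + 2), by positivity, half_lt_self (by positivity)⟩
  have hψr : Tendsto (fun l => (ψ l).rOut) atTop (𝓝 0) :=
    (tendsto_const_nhds (x := r)).div_atTop
      (tendsto_atTop_add_const_right _ _ tendsto_natCast_atTop_atTop)
  have hψlt : ∀ l, (ψ l).rOut < r := fun l => by
    refine div_lt_self hr ?_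
    have : (0 : ℝ) ≤ l := l.cast_nonneg
    linarith
  set F : ℕ → E → ℝ := fun l => (ψ l).normed μ ⋆[ContinuousLinearMap.mul ℝ ℝ, μ] f
  have hae : ∀ᵐ z ∂μ, Tendsto (fun l => F l z) atTop (𝓝 (f z)) :=
    ContDiffBump.ae_convolution_tendsto_right_of_locallyIntegrable (K := 2) hψr
      (Eventually.of_forall fun l => le_of_eq (by simp only [ψ]; ring)) hf
  have hF : ∀ l, ContDiff ℝ 1 (F l) := fun l =>
    (ψ l).hasCompactSupport_normed.contDiff_convolution_left _ (ψ l).contDiff_normed hf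
  have hF0 : ∀ l, ∀ z ∈ ball z₀ r, fderiv ℝ (F l) z = 0 := by
    intro l z hz
    ext v
    set κ := (ψ l).normed μ
    have hκ : ContDiff ℝ ∞ κ := (ψ l).contDiff_normed
    have hκc : HasCompactSupport κ := (ψ l).hasCompactSupport_normed
    rw [fderiv_convolution_left_apply μ hκc (hκ.of_le (by norm_num)) hf,
      ← integral_sub_left_eq_self _ μ z]
    have hts : tsupport (fun w => κ (z - w)) ⊆ Ω := by
      refine (tsupport_comp_subset_preimage κ (continuous_const.sub continuous_id)).trans
        fun w hw => hball ?_
      have hw' : z - w ∈ closedBall (0 : E) (ψ l).rOut := by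
        rw [← (ψ l).tsupport_normed_eq (μ := μ)]; exact hw
      rw [mem_closedBall_zero_iff, ← dist_eq_norm] at hw'
      rw [mem_ball] at hz ⊢
      have := dist_triangle_left w z₀ z
      linarith [hψlt l]
    have key := h (fun w => κ (z - w)) (hκ.comp (contDiff_const.sub contDiff_id))
      (hκc.comp_homeomorph (Homeomorph.subLeft z)) hts v
    have hd : ∀ w, fderiv ℝ (fun w => κ (z - w)) w v = - fderiv ℝ κ (z - w) v := fun w => by
      have h1 : HasFDerivAt (fun w => z - w) (-ContinuousLinearMap.id ℝ E) w := by
        simpa using (hasFDerivAt_id w).const_sub z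
      have h2 : HasFDerivAt (fun w => κ (z - w)) _ w :=
        ((hκ.differentiable (by norm_num)) (z - w)).hasFDerivAt.comp w h1
      rw [h2.fderiv]
      simp
    simp only [hd, mul_neg, integral_neg, neg_eq_zero] at key
    simpa [mul_comm] using key
  have hconst : ∀ l, ∀ z ∈ ball z₀ r, ∀ w ∈ ball z₀ r, F l z = F l w := fun l z hz w hw =>
    isOpen_ball.is_const_of_fderiv_eq_zero (convex_ball z₀ r).isPreconnected
      ((hF l).differentiable one_ne_zero).differentiableOn (hF0 l) hz hw
  have hae' := ae_restrict_of_ae (s := ball z₀ r) hae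
  have hne : (ae (μ.restrict (ball z₀ r))).NeBot := by
    rw [ae_neBot, Ne, Measure.restrict_eq_zero]
    exact (measure_ball_pos μ z₀ hr).ne'
  obtain ⟨z₁, hz₁, hz₁b⟩ := (hae'.and (ae_restrict_mem measurableSet_ball)).exists
  refine ⟨z₁, hz₁b, ?_⟩
  filter_upwards [hae', ae_restrict_mem measurableSet_ball] with z hz hzb
  exact tendsto_nhds_unique hz (hz₁.congr fun l => hconst l _ hz₁b _ hzb)

/-- The indicator of a measurable set with vanishing distributional gradient in a connected open
set is almost everywhere constant there. -/
theorem ae_mem_or_ae_notMem_of_integral_indicator_fderiv_eq_zero {S Ω : Set E}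
    (hS : MeasurableSet S) (hΩ : IsOpen Ω) (hΩc : IsConnected Ω)
    (h : ∀ φ : E → ℝ, ContDiff ℝ ∞ φ → HasCompactSupport φ → tsupport φ ⊆ Ω →
      ∀ v, ∫ z, S.indicator 1 z * fderiv ℝ φ z v ∂μ = 0) :
    (∀ᵐ z ∂(μ.restrict Ω), z ∈ S) ∨ (∀ᵐ z ∂(μ.restrict Ω), z ∉ S) := by
  have hf : LocallyIntegrable (S.indicator (1 : E → ℝ)) μ :=
    (locallyIntegrable_const (1 : ℝ)).indicator hS
  have : ProperSpace E := FiniteDimensional.proper_real E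
  have hcover : ∀ z ∈ Ω, (∃ r > 0, ∀ᵐ w ∂(μ.restrict (ball z r)), w ∈ S) ∨
      (∃ r > 0, ∀ᵐ w ∂(μ.restrict (ball z r)), w ∉ S) := by
    intro z hz
    obtain ⟨r, hr, hrΩ⟩ := Metric.isOpen_iff.1 hΩ z hz
    obtain ⟨z₁, -, hz₁⟩ := ae_const_on_ball_of_integral_mul_fderiv_eq_zero μ hf h
      (half_pos hr) (by rwa [mul_div_cancel₀ r two_ne_zero])
    by_cases hm : z₁ ∈ S
    · refine Or.inl ⟨r / 2, half_pos hr, hz₁.mono fun w hw => ?_⟩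
      by_contra hwS
      simp [hm, hwS] at hw
    · refine Or.inr ⟨r / 2, half_pos hr, hz₁.mono fun w hw hwS => ?_⟩
      simp [hm, hwS] at hw
  have hdisj : ∀ z, (∃ r > 0, ∀ᵐ w ∂(μ.restrict (ball z r)), w ∈ S) →
      (∃ r > 0, ∀ᵐ w ∂(μ.restrict (ball z r)), w ∉ S) → False := by
    rintro z ⟨r, hr, h1⟩ ⟨s, hs, h2⟩
    have hne : (ae (μ.restrict (ball z (min r s)))).NeBot := by
      rw [ae_neBot, Ne, Measure.restrict_eq_zero]
      exact (measure_ball_pos μ z (lt_min hr hs)).ne'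
    obtain ⟨w, hw1, hw2⟩ := ((ae_restrict_of_ae_restrict_of_subset
      (ball_subset_ball (min_le_left r s)) h1).and (ae_restrict_of_ae_restrict_of_subset
      (ball_subset_ball (min_le_right r s)) h2)).exists
    exact hw2 hw1
  -- The points near which `S` has full measure and those near which it is null form two disjoint
  -- open sets covering `Ω`.
  rcases isPreconnected_iff_subset_of_disjoint.1 hΩc.isPreconnected _ _
    (isOpen_setOf_ae_ball μ (· ∈ S)) (isOpen_setOf_ae_ball μ (· ∉ S)) hcover
    (eq_empty_of_forall_notMem fun z hz => hdisj z hz.2.1 hz.2.2) with h1 | h1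
  · exact Or.inl (ae_restrict_of_forall_ae_ball μ h1 hΩ.measurableSet)
  · exact Or.inr (ae_restrict_of_forall_ae_ball μ h1 hΩ.measurableSet)

end LocallyConstant

/-! ### The indicator of the positivity set has zero gradient. -/

section Positivity

variable {n m : ℕ} {γ : ℝ} {Ω : Set (Space n m)} {u : Space n m → ℝ}
  {G : Space n m → EuclideanSpace ℝ (Fin n ⊕ Fin m)}

/-- Here `δ = exp (-(l + 1))`, so that `log (1 / δ) = l + 1` never vanishes. -/
theorem tendsto_log_add_exp_neg_div {a : ℝ} (ha : 0 ≤ a) :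
    Tendsto (fun l : ℕ => (Real.log (a + Real.exp (-(l + 1 : ℝ))) -
      Real.log (Real.exp (-(l + 1 : ℝ)))) / (l + 1 : ℝ)) atTop (𝓝 (if 0 < a then 1 else 0)) := by
  have hl : Tendsto (fun l : ℕ => (l + 1 : ℝ)) atTop atTop :=
    tendsto_atTop_add_const_right _ _ tendsto_natCast_atTop_atTop
  split_ifs with h
  · have h1 : Tendsto (fun l : ℕ => Real.log (a + Real.exp (-(l + 1 : ℝ)))) atTop
        (𝓝 (Real.log (a + 0))) :=
      (tendsto_const_nhds.add (Real.tendsto_exp_neg_atTop_nhds_zero.comp hl)).log (by simpa using h.ne')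
    have h2 := (h1.div_atTop hl).add (tendsto_const_nhds (x := (1 : ℝ)))
    rw [zero_add] at h2
    refine h2.congr fun l => ?_
    have : (l + 1 : ℝ) ≠ 0 := by positivity
    rw [Real.log_exp]; field_simp; ring
  · have : a = 0 := le_antisymm (not_lt.1 h) ha
    simp [this]

theorem abs_log_add_exp_neg_div_le {a : ℝ} (ha : 0 ≤ a) (l : ℕ) :
    |(Real.log (a + Real.exp (-(l + 1 : ℝ))) - Real.log (Real.exp (-(l + 1 : ℝ)))) / (l + 1 : ℝ)| ≤
      a + 1 := by
  have hl : (1 : ℝ) ≤ l + 1 := by simp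
  have hl0 : (0 : ℝ) < l + 1 := by linarith
  have he := Real.exp_pos (-(l + 1 : ℝ))
  have h0 : 0 ≤ Real.log (a + Real.exp (-(l + 1 : ℝ))) - Real.log (Real.exp (-(l + 1 : ℝ))) :=
    sub_nonneg.2 (Real.log_le_log he (by linarith))
  rw [abs_of_nonneg (by positivity), div_le_iff₀ hl0, Real.log_exp]
  have h1 : Real.log (a + Real.exp (-(l + 1 : ℝ))) ≤ a := by
    have h2 := Real.log_le_sub_one_of_pos (x := a + Real.exp (-(l + 1 : ℝ))) (by positivity)
    have h3 : Real.exp (-(l + 1 : ℝ)) ≤ 1 := Real.exp_le_one_iff.2 (by linarith)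
    linarith
  nlinarith

/-- By the chain rule the tested gradient of the normalized logarithm is `O(1 / (l + 1))`, thanks to
the `δ`-uniform energy bound; its left side converges to the integral with the indicator, dominated
by means of `u + 1`. -/
theorem integral_indicator_pos_mul_grad_eq_zero (hγ : 0 < γ) (hΩ : IsOpen Ω)
    (hu : MemH1With γ Ω u G)
    (hu0 : ∀ᵐ z ∂(volume.restrict Ω), 0 ≤ u z) {h : Space n m → ℝ}
    (hh : ∀ K, IsCompact K → K ⊆ Ω → IntegrableOn h K)
    (hhu : LocallyIntegrableOn (fun z => h z * u z) Ω)
    (hsup : ∀ φ, IsTestFunction Ω φ → (∀ z, 0 ≤ φ z) →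
      0 ≤ ∫ z in Ω, (inner ℝ (G z) (grad γ φ z) + h z * u z * φ z))
    {φ : Space n m → ℝ} (hφ : IsTestFunction Ω φ) (k : Fin n ⊕ Fin m) :
    ∫ z in tsupport φ, (if 0 < u z then 1 else 0) * grad γ φ z k = 0 := by
  obtain ⟨C, hC⟩ := exists_energy_bound hγ hΩ hu hu0 hh hhu hsup hφ
  have hlog := fun {δ : ℝ} (hδ : 0 < δ) => integral_log_mul_grad hγ hΩ hu hu0 hφ hδ k
  have hL := fun {δ : ℝ} (hδ : 0 < δ) => memLp_mul_inv_add_mul_grad (k := k) hu hu0 hφ hδ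
  have hres : volume.restrict (tsupport φ) ≤ volume.restrict Ω :=
    Measure.restrict_mono hφ.2.2 le_rfl
  have hK : IsCompact (tsupport φ) := hφ.2.1
  have : IsFiniteMeasure (volume.restrict (tsupport φ)) := ⟨by simpa using hK.measure_lt_top⟩
  have hu0' := hu0.filter_mono (ae_mono hres)
  have hu2 := hu.1.mono_measure hres
  have hg2 := memLp_restrict_of_continuous (continuous_grad hγ hφ.1 k) hK 2
  have hg1 := memLp_restrict_of_continuous (continuous_grad hγ hφ.1 k) hK 1
  set d : ℕ → ℝ := fun l => Real.exp (-(l + 1 : ℝ)) with hd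
  have hd0 : ∀ l, 0 < d l := fun l => Real.exp_pos _
  have h1 : Tendsto (fun l : ℕ => ∫ z in tsupport φ,
      (Real.log (u z + d l) - Real.log (d l)) / (l + 1 : ℝ) * grad γ φ z k) atTop
      (𝓝 (∫ z in tsupport φ, (if 0 < u z then 1 else 0) * grad γ φ z k)) := by
    refine tendsto_integral_of_dominated_convergence (fun z => (u z + 1) * ‖grad γ φ z k‖)
      (fun l => ?_) ?_ (fun l => ?_) ?_
    · exact (((hu2.1.aemeasurable.add_const _).log.sub_const _).div_const
        _).aestronglyMeasurable.mul hg2.1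
    · have i1 := (hu2.integrable_mul hg2.norm).add (memLp_one_iff_integrable.1 hg1).norm
      refine i1.congr (Eventually.of_forall fun z => ?_)
      simp only [Pi.add_apply, Pi.mul_apply]; ring
    · filter_upwards [hu0'] with z hz
      rw [norm_mul]
      gcongr
      exact abs_log_add_exp_neg_div_le hz l
    · filter_upwards [hu0'] with z hz
      exact (tendsto_log_add_exp_neg_div hz).mul_const _
  have h2 : ∀ l : ℕ, |∫ z in tsupport φ,
      (Real.log (u z + d l) - Real.log (d l)) / (l + 1 : ℝ) * grad γ φ z k| ≤
      (C + volume.real (tsupport φ)) / (l + 1 : ℝ) := by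
    intro l
    have e : ∫ z in tsupport φ,
        (Real.log (u z + d l) - Real.log (d l)) / (l + 1 : ℝ) * grad γ φ z k =
        - (∫ z in tsupport φ, φ z * (u z + d l)⁻¹ * G z k) / (l + 1 : ℝ) := by
      rw [← hlog (hd0 l), ← integral_div]
      congr 1; ext z; ring
    have i2 := (hL (hd0 l)).integrable_sq
    rw [e, abs_div, abs_neg, abs_of_pos (show (0 : ℝ) < l + 1 by positivity)]
    gcongr
    calc |∫ z in tsupport φ, φ z * (u z + d l)⁻¹ * G z k|
        ≤ ∫ z in tsupport φ, |φ z * (u z + d l)⁻¹ * G z k| := abs_integral_le_integral_abs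
      -- The bound `|t| ≤ t² + 1` on a set of finite measure replaces Cauchy–Schwarz.
      _ ≤ ∫ z in tsupport φ, ((φ z * (u z + d l)⁻¹ * G z k) ^ 2 + 1) := by
          refine integral_mono ((hL (hd0 l)).integrable (by norm_num)).abs
            (i2.add (integrable_const 1)) fun z => ?_
          dsimp only
          rw [← sq_abs]
          nlinarith [sq_nonneg (|φ z * (u z + d l)⁻¹ * G z k| - 1),
            abs_nonneg (φ z * (u z + d l)⁻¹ * G z k)]
      _ ≤ C + volume.real (tsupport φ) := by
          rw [integral_add i2 (integrable_const 1)]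
          have := hC (d l) (hd0 l) k
          simpa using this
  have h3 : Tendsto (fun l : ℕ => (C + volume.real (tsupport φ)) / (l + 1 : ℝ)) atTop (𝓝 0) :=
    tendsto_const_nhds.div_atTop
      (tendsto_atTop_add_const_right _ _ tendsto_natCast_atTop_atTop)
  exact tendsto_nhds_unique h1 (squeeze_zero_norm h2 h3)

theorem ae_fst_ne_zero (hn : 1 ≤ n) : ∀ᵐ z : Space n m, z.1 ≠ 0 := by
  have : Nonempty (Fin n) := ⟨⟨0, hn⟩⟩
  have h : ∀ᵐ x : EuclideanSpace ℝ (Fin n), x ≠ 0 := by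
    simp [ae_iff]
  exact Measure.quasiMeasurePreserving_fst.ae h

/-- A bounded function with vanishing weak Grushin gradient has vanishing weak gradient. -/
theorem integral_mul_fderiv_eq_zero_of_integral_mul_grad_eq_zero (hn : 1 ≤ n) (hγ : 0 < γ)
    {f : Space n m → ℝ} (hf : Measurable f) {M : ℝ} (hM : ∀ z, ‖f z‖ ≤ M)
    (h : ∀ φ, IsTestFunction Ω φ → ∀ k, ∫ z, f z * grad γ φ z k = 0)
    {φ : Space n m → ℝ} (hφ : IsTestFunction Ω φ) (v : Space n m) :
    ∫ z, f z * fderiv ℝ φ z v = 0 := by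
  have hDc : ∀ v, Continuous fun z => fderiv ℝ φ z v := fun v =>
    (hφ.1.continuous_fderiv (by norm_num)).clm_apply continuous_const
  have hDi : ∀ v, Integrable fun z => fderiv ℝ φ z v := fun v =>
    (hDc v).integrable_of_hasCompactSupport (hφ.2.1.fderiv_apply ℝ v)
  have hfi : ∀ v, Integrable fun z => f z * fderiv ℝ φ z v := fun v =>
    (hDi v).bdd_mul hf.aestronglyMeasurable (Eventually.of_forall hM)
  have hdir : ∀ k, ∫ z, f z * fderiv ℝ φ z (dir k) = 0 := by
    intro k
    cases k with
    | inl i => simpa [grad_apply, coef] using h φ hφ (.inl i)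
    | inr j =>
      -- A smooth regularization of `|x|^(-γ)`. Since `q l` depends on `x` only, `∂_y` passes
      -- through it, and `|x|^γ q l` is bounded by `1` and tends to `1` off `{x = 0}`.
      set q : ℕ → EuclideanSpace ℝ (Fin n) → ℝ := fun l x =>
        (‖x‖ ^ 2 + 1 / (l + 1 : ℝ)) ^ (-(γ / 2)) with hq
      have hpos : ∀ (l : ℕ) (x : EuclideanSpace ℝ (Fin n)), 0 < ‖x‖ ^ 2 + 1 / (l + 1 : ℝ) :=
        fun l x => by positivity
      have hqs : ∀ l, ContDiff ℝ ∞ (q l) := fun l =>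
        ((contDiff_norm_sq ℝ).add contDiff_const).rpow_const_of_ne fun x => (hpos l x).ne'
      have hψ : ∀ l, IsTestFunction Ω fun z => q l z.1 * φ z := fun l =>
        ⟨((hqs l).comp contDiff_fst).mul hφ.1, hφ.2.1.mul_left,
          tsupport_mul_subset_right.trans hφ.2.2⟩
      have hgrad : ∀ l z, grad γ (fun z => q l z.1 * φ z) z (.inr j) =
          (1 + γ) * (‖z.1‖ ^ γ * q l z.1 * fderiv ℝ φ z (dir (.inr j))) := fun l z => by
        have h1 := ((hφ.1.differentiable (by norm_num)) z).hasFDerivAt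
        have h2 : HasFDerivAt (fun z : Space n m => q l z.1) _ z :=
          (((hqs l).differentiable (by norm_num)) z.1).hasFDerivAt.comp z hasFDerivAt_fst
        have h3 : HasFDerivAt (fun z => q l z.1 * φ z) _ z := h2.mul h1
        rw [grad_apply, h3.fderiv]
        simp [coef, dir]
        ring
      have hzero : ∀ l, ∫ z, ‖z.1‖ ^ γ * q l z.1 * (f z * fderiv ℝ φ z (dir (.inr j))) = 0 :=
        fun l => by
          have := h _ (hψ l) (.inr j)
          simp only [hgrad] at this
          rw [← mul_right_inj' (show (1 + γ) ≠ 0 by positivity), mul_zero, ← integral_const_mul,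
            ← this]
          congr 1; ext z; ring
      have hpow : ∀ x : EuclideanSpace ℝ (Fin n), ‖x‖ ^ γ = (‖x‖ ^ 2) ^ (γ / 2) := fun x => by
        rw [← Real.rpow_natCast, ← Real.rpow_mul (norm_nonneg _)]
        congr 1; push_cast; ring
      have hle : ∀ (l : ℕ) (x : EuclideanSpace ℝ (Fin n)), ‖‖x‖ ^ γ * q l x‖ ≤ 1 := fun l x => by
        have h0 := hpos l x
        rw [Real.norm_of_nonneg (by positivity), hpow]
        simp only [hq]
        rw [Real.rpow_neg h0.le, ← div_eq_mul_inv]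
        refine div_le_one_of_le₀ ?_ (by positivity)
        gcongr
        exact le_add_of_nonneg_right (by positivity)
      have hlim : Tendsto (fun l => ∫ z, ‖z.1‖ ^ γ * q l z.1 * (f z * fderiv ℝ φ z (dir (.inr j))))
          atTop (𝓝 (∫ z, 1 * (f z * fderiv ℝ φ z (dir (.inr j))))) := by
        refine tendsto_integral_bdd_mul (M := 1) (fun l => ?_)
          (fun l => Eventually.of_forall fun z => hle l z.1) ?_ (hfi _)
        · exact (((continuous_norm.rpow_const fun _ => Or.inr hγ.le).comp continuous_fst).mul
            ((hqs l).continuous.comp continuous_fst)).aestronglyMeasurable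
        · filter_upwards [ae_fst_ne_zero hn] with z hz
          have hz2 : ‖z.1‖ ^ 2 ≠ 0 := by simpa using hz
          have h1 : Tendsto (fun l : ℕ => ‖z.1‖ ^ 2 + 1 / (l + 1 : ℝ)) atTop
              (𝓝 (‖z.1‖ ^ 2 + 0)) :=
            tendsto_const_nhds.add tendsto_one_div_add_atTop_nhds_zero_nat
          rw [add_zero] at h1
          have h2 := (h1.rpow_const (p := -(γ / 2)) (Or.inl hz2)).const_mul (‖z.1‖ ^ γ)
          have h3 : ‖z.1‖ ^ γ * (‖z.1‖ ^ 2) ^ (-(γ / 2)) = 1 := by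
            rw [hpow, ← Real.rpow_add (by positivity)]; simp
          rwa [h3] at h2
      simp only [hzero, one_mul] at hlim
      exact (tendsto_nhds_unique hlim tendsto_const_nhds)
  have hv : v = ∑ k, (Sum.elim (fun i => v.1 i) (fun j => v.2 j) k : ℝ) • dir k := by
    rw [Fintype.sum_sum_type]
    refine Prod.ext ?_ ?_
    · ext i
      simp [dir, Prod.fst_sum]
      simp [Pi.single_apply]
    · ext i
      simp [dir, Prod.snd_sum]
      simp [Pi.single_apply]
  rw [hv]
  simp only [map_sum, map_smul, smul_eq_mul, Finset.mul_sum]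
  rw [integral_finsetSum]
  · refine Finset.sum_eq_zero fun k _ => ?_
    rw [← mul_zero (Sum.elim (fun i => v.1 i) (fun j => v.2 j) k : ℝ), ← hdir k,
      ← integral_const_mul]
    congr 1; ext z; ring
  · intro k _
    refine ((hfi (dir k)).const_mul (Sum.elim (fun i => v.1 i) (fun j => v.2 j) k : ℝ)).congr
      (Eventually.of_forall fun z => ?_)
    dsimp only; ring

theorem MemLpLoc.integrableOn {h : Space n m → ℝ} {q : ℝ} (hq : 1 ≤ q) (hh : MemLpLoc Ω h q)
    {K : Set (Space n m)} (hK : IsCompact K) (hKΩ : K ⊆ Ω) : IntegrableOn h K := by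
  have : IsFiniteMeasure (volume.restrict K) := ⟨by simpa using hK.measure_lt_top⟩
  exact (hh K hK hKΩ).integrable (by simpa using hq)

/-- Equivalent to `Q ≥ 2`, which follows from `n, m ≥ 1`; it makes `h` locally integrable. -/
theorem one_le_two_mul_homDim_div (hγ : 0 < γ) (hn : 1 ≤ n) (hm : 1 ≤ m) :
    1 ≤ 2 * homDim γ n m / (homDim γ n m + 2) := by
  have hn' : (1 : ℝ) ≤ n := by exact_mod_cast hn
  have hm' : (1 : ℝ) ≤ m := by exact_mod_cast hm
  have hQ : 2 ≤ homDim γ n m := by unfold homDim; nlinarith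
  rw [le_div_iff₀ (by linarith)]
  linarith

end Positivity
end Grushin

theorem mainTheorem9 (γ : ℝ) (hγ : 0 < γ) (n m : ℕ) (hn : 1 ≤ n) (hm : 1 ≤ m)
    (Ω : Set (Grushin.Space n m)) (hΩ : IsOpen Ω) (hΩc : IsConnected Ω)
    (h u : Grushin.Space n m → ℝ)
    (hh : Grushin.MemLpLoc Ω h
      (2 * Grushin.homDim γ n m / (Grushin.homDim γ n m + 2)))
    (hu : Grushin.IsSupersolution γ Ω h u)
    (hu_nonneg : ∀ᵐ z ∂(volume.restrict Ω), 0 ≤ u z) :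
    (∀ᵐ z ∂(volume.restrict Ω), 0 < u z) ∨ (∀ᵐ z ∂(volume.restrict Ω), u z = 0) := by
  obtain ⟨G, hG, hhu, hsup⟩ := hu
  have hhK := fun K hK hKΩ => hh.integrableOn (Grushin.one_le_two_mul_homDim_div hγ hn hm)
    (K := K) hK hKΩ
  -- A measurable representative makes the positivity set measurable.
  obtain ⟨U, hUm, -, hU⟩ := Grushin.exists_measurable_extension hΩ.measurableSet hG.1
  have hS : MeasurableSet {z | 0 < U z} := measurableSet_lt measurable_const hUm
  have hgrad : ∀ φ, Grushin.IsTestFunction Ω φ → ∀ k,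
      ∫ z, {z | 0 < U z}.indicator (1 : Grushin.Space n m → ℝ) z * Grushin.grad γ φ z k = 0 := by
    intro φ hφ k
    refine Eq.trans ?_ (Grushin.integral_indicator_pos_mul_grad_eq_zero hγ hΩ hG hu_nonneg hhK hhu
      hsup hφ k)
    rw [← setIntegral_eq_integral_of_forall_compl_eq_zero (s := tsupport φ)]
    · refine integral_congr_ae ?_
      filter_upwards [hU.filter_mono (ae_mono (Measure.restrict_mono hφ.2.2 le_rfl))] with z hz
      simp [indicator_apply, hz]
    · intro z hz
      rw [Grushin.grad_eq_zero_of_notMem_tsupport hz, mul_zero]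
  have hfd := Grushin.ae_mem_or_ae_notMem_of_integral_indicator_fderiv_eq_zero volume hS hΩ hΩc
    fun φ h1 h2 h3 v => Grushin.integral_mul_fderiv_eq_zero_of_integral_mul_grad_eq_zero hn hγ
      (measurable_one.indicator hS) (M := 1)
      (fun z => by by_cases hz : 0 < U z <;> simp [hz]) hgrad ⟨h1, h2, h3⟩ v
  refine hfd.imp (fun h => ?_) fun h => ?_
  · filter_upwards [h, hU] with z hz hzU
    rw [← hzU]; exact hz
  · filter_upwards [h, hU, hu_nonneg] with z hz hzU hz0
    refine le_antisymm (not_lt.1 fun hlt => hz ?_) hz0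
    rw [← hzU] at hlt; exact hlt
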